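/- Let $A\in\mathbb R^{n\times n}$, $B\in\mathbb R^{n\times m}$, $C\in\mathbb R^{p\times n}$, $S\in\mathbb R^{q\times q}$, and let $(G_1,G_2)$ be a minimal $p$-copy internal model of $S$; that is, $G_1=\operatorname{blockdiag}(\beta,\dots,\beta)\in\mathbb R^{n_z\times n_z}$ and $G_2=\operatorname{blockdiag}(\sigma,\dots,\sigma)\in\mathbb R^{n_z\times p}$ ($p$ copies each), where $\beta$ is a real square matrix whose characteristic polynomial equals the minimal polynomial of $S$ and $\sigma$ is a real column vector such that $(\beta,\sigma)$ is controllable. Assume that 1. all the eigenvalues of $S$ lie on the imaginary axis; 2. $(A,B)$ is stabilizable; 3. $\operatorname{rank}\begin{pmatrix}A-\lambda I_n & B\\ C&0\end{pmatrix}=n+p$ for every eigenvalue $\lambda\in\mathbb C$ of $S$; 4. $A$ has no eigenvalues with positive real part. Put $\mathcal A=\begin{pmatrix}A&0\\ G_2C&G_1\end{pmatrix}$ and $\mathcal B=\begin{pmatrix}B\\0\end{pmatrix}$. Let $\tau\ge 0$ and let $\lambda_1,\dots,\lambda_N\in\mathbb C$ be finitely many given numbers with $\operatorname{Re}\lambda_i>0$.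 Then there exists a single matrix $K\in\mathbb R^{m\times(n+n_z)}$ (which may depend on $\tau$ and on $\lambda_1,\dots,\lambda_N$, but not on $i$) such that the state feedback $u_i(t)=Kx_i(t)$ asymptotically stabilizes all the systems $\dot x_i(t)=\mathcal A x_i(t)+\lambda_i\mathcal B u_i(t-\tau)$, $i=1,\dots,N$. That is, for each $i$ the zero solution of $$\dot x_i(t)=\mathcal A x_i(t)+\lambda_i\mathcal B K x_i(t-\tau),\qquad t\ge 0,$$ with states in $\mathbb C^{n+n_z}$ and continuous initial functions on $[-\tau,0]$, is Lyapunov stable (with respect to the supremum norm of the initial function), and every solution tends to $0$ as $t\to\infty$. -/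

import Mathlib

open scoped Topology Kronecker

namespace DelayReg

/-- A real matrix regarded as a complex matrix. -/
noncomputable def toC {ι κ : Type*} (M : Matrix ι κ ℝ) : Matrix ι κ ℂ :=
  M.map (fun r : ℝ => (r : ℂ))

/-- The set of (complex) eigenvalues of a real square matrix. -/
noncomputable def eigs {ι : Type*} [Fintype ι] [DecidableEq ι] (M : Matrix ι ι ℝ) : Set ℂ :=
  spectrum ℂ (toC M)

/-- All eigenvalues lie in the open left half plane. -/
def IsHurwitz {ι : Type*} [Fintype ι] [DecidableEq ι] (M : Matrix ι ι ℝ) : Prop :=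
  ∀ μ ∈ eigs M, μ.re < 0

/-- The pair `(A, B)` is stabilizable: some real state feedback makes `A + B F` Hurwitz. -/
def Stabilizable {n m : ℕ} (A : Matrix (Fin n) (Fin n) ℝ) (B : Matrix (Fin n) (Fin m) ℝ) : Prop :=
  ∃ F : Matrix (Fin m) (Fin n) ℝ, IsHurwitz (A + B * F)

/-- The controllability matrix `(B, A B, …, A ^ (n - 1) B)`. -/
def ctrbMatrix {n m : ℕ} (A : Matrix (Fin n) (Fin n) ℝ) (B : Matrix (Fin n) (Fin m) ℝ) :
    Matrix (Fin n) (Fin n × Fin m) ℝ :=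
  Matrix.of fun i kj => (A ^ (kj.1 : ℕ) * B) i kj.2

/-- The pair `(A, B)` is controllable. -/
def Controllable {n m : ℕ} (A : Matrix (Fin n) (Fin n) ℝ) (B : Matrix (Fin n) (Fin m) ℝ) : Prop :=
  (ctrbMatrix A B).rank = n

/-- For all `μ ∈ σ(S)`, the matrix `[A - μ I, B; C, 0]` has rank `n + p`. -/
def RankCondition {n m p q : ℕ} (A : Matrix (Fin n) (Fin n) ℝ) (B : Matrix (Fin n) (Fin m) ℝ)
    (C : Matrix (Fin p) (Fin n) ℝ) (S : Matrix (Fin q) (Fin q) ℝ) : Prop :=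
  ∀ μ ∈ eigs S,
    (Matrix.fromBlocks (toC A - μ • (1 : Matrix (Fin n) (Fin n) ℂ)) (toC B) (toC C) 0).rank = n + p

/-- `(G₁, G₂)` is a minimal `p`-copy internal model of `S`: `G₁ = blockdiag (β, …, β)` and
`G₂ = blockdiag (σ, …, σ)` with `p` copies, where `β` is a square matrix whose characteristic
polynomial is the minimal polynomial of `S` and `σ` is a column with `(β, σ)` controllable.
The row index `(j, k)` is the `k`-th row of the `j`-th block. -/
def IsMinimalInternalModel {p q s : ℕ} (S : Matrix (Fin q) (Fin q) ℝ)
    (G₁ : Matrix (Fin p × Fin s) (Fin p × Fin s) ℝ) (G₂ : Matrix (Fin p × Fin s) (Fin p) ℝ) :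
    Prop :=
  ∃ (β : Matrix (Fin s) (Fin s) ℝ) (σ : Fin s → ℝ),
    β.charpoly = minpoly ℝ S ∧
    Controllable β (Matrix.replicateCol (Fin 1) σ) ∧
    G₁ = (1 : Matrix (Fin p) (Fin p) ℝ) ⊗ₖ β ∧
    G₂ = Matrix.of fun jk l => if jk.1 = l then σ jk.2 else 0

/-- The augmented state matrix `[A, 0; G₂ C, G₁]`. -/
def augA {n p s : ℕ} (A : Matrix (Fin n) (Fin n) ℝ) (C : Matrix (Fin p) (Fin n) ℝ)
    (G₁ : Matrix (Fin p × Fin s) (Fin p × Fin s) ℝ) (G₂ : Matrix (Fin p × Fin s) (Fin p) ℝ) :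
    Matrix (Fin n ⊕ Fin p × Fin s) (Fin n ⊕ Fin p × Fin s) ℝ :=
  Matrix.fromBlocks A 0 (G₂ * C) G₁

/-- The augmented input matrix `[B; 0]`. -/
def augB {n m : ℕ} (p s : ℕ) (B : Matrix (Fin n) (Fin m) ℝ) :
    Matrix (Fin n ⊕ Fin p × Fin s) (Fin m) ℝ :=
  Matrix.fromRows B 0

/-- `x`, continuous on `[-τ, ∞)`, solves `x'(t) = M x(t) + l L u(t - τ)` for all `t ≥ 0`
(one-sided derivative at `0`). -/
def IsTrajectory {ι κ : Type*} [Fintype ι] [Fintype κ] (M : Matrix ι ι ℝ) (L : Matrix ι κ ℝ)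
    (l : ℂ) (τ : ℝ) (u : ℝ → κ → ℂ) (x : ℝ → ι → ℂ) : Prop :=
  ContinuousOn x (Set.Ici (-τ)) ∧
  ∀ t : ℝ, 0 ≤ t →
    HasDerivWithinAt x ((toC M).mulVec (x t) + l • (toC L).mulVec (u (t - τ))) (Set.Ici 0) t

/-- `x` is a solution of the closed loop obtained from the feedback `u(t) = K x(t)`. -/
def IsClosedLoop {ι κ : Type*} [Fintype ι] [Fintype κ] (M : Matrix ι ι ℝ) (L : Matrix ι κ ℝ)
    (l : ℂ) (τ : ℝ) (K : Matrix κ ι ℝ) (x : ℝ → ι → ℂ) : Prop :=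
  IsTrajectory M L l τ (fun t => (toC K).mulVec (x t)) x

/-- The feedback `u(t) = K x(t)` asymptotically stabilizes `x'(t) = M x(t) + l L u(t - τ)`:
the zero solution of the closed loop is Lyapunov stable with respect to the supremum norm of the
initial function on `[-τ, 0]`, and every solution tends to zero. -/
def AsymptoticallyStabilizes {ι κ : Type*} [Fintype ι] [Fintype κ] (M : Matrix ι ι ℝ)
    (L : Matrix ι κ ℝ) (l : ℂ) (τ : ℝ) (K : Matrix κ ι ℝ) : Prop :=
  (∀ ε : ℝ, 0 < ε → ∃ δ : ℝ, 0 < δ ∧ ∀ x : ℝ → ι → ℂ, IsClosedLoop M L l τ K x →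
      (∀ θ ∈ Set.Icc (-τ) 0, ‖x θ‖ ≤ δ) → ∀ t : ℝ, 0 ≤ t → ‖x t‖ ≤ ε) ∧
  (∀ x : ℝ → ι → ℂ, IsClosedLoop M L l τ K x → Filter.Tendsto x Filter.atTop (𝓝 0))

end DelayReg

/-!
The feedback is a low gain *truncated predictor feedback* `u = -c Bᵀ P exp(A τ) x` for the augmented
pair, written `(A, B)` here.

Two properties of the pair are needed: no eigenvalue of `A` has positive real part
(`not_re_pos_of_mem_eigs_augA`), and no left eigenvector of `A` with imaginary eigenvalue is
annihilated by `B` (`eq_zero_of_augA_eigenvector`). The second one combines stabilizability, the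
rank condition at the eigenvalues of `S` and the controllability of `(β, σ)`.

Let `Q` be the spectral projection of `A` onto the modes on the imaginary axis, a real polynomial in
`A`. On its range `-(A + ε / 2)` is Hurwitz, and the inverse of the Gramian of this matrix gives a
solution `P` of the parametric Riccati equation `Aᵀ P + P A - P B Bᵀ P = -ε P`
(`exists_parametric_riccati`). Taking traces, `tr (Bᵀ P B) = O(ε)`, since the trace of `A` on the
range of `Q` is zero. Hence, measured in the form of `P`, the feedback is of order `ε`.

Along the closed loop, `exp(A τ) x(t - τ)` differs from `x(t)` by an integral over the delayed
inputs, so that the error of the prediction is again of the order of the gain. If `c Re λᵢ ≥ 1`, then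
`V = x* P x` satisfies `V' ≤ -ε V + O(ε³) sup V` with the supremum over `[t - 2 τ, t]`
(`IsRiccatiSolution.two_mul_re_hform_closedLoop_le`). The remaining modes are stable: `A - Q` is
Hurwitz, with Lyapunov matrix `R`, and `x* R x` decays up to terms bounded by `V`. Halanay's
inequality (`exists_halanay_rate`), applied to `V + δ x* R x` with a small `δ > 0`, gives exponential
decay as soon as `ε` is small. How small `ε` must be depends on the numbers `λᵢ` only through an upper
bound for `c |λᵢ|`, and therefore one feedback serves all of them.
-/

namespace DelayReg

open Matrix

variable {ι κ ν : Type*}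

/-! ### Complexification of real matrices -/

section ToC

@[simp] lemma toC_apply (M : Matrix ι κ ℝ) (i : ι) (j : κ) : toC M i j = (M i j : ℂ) := rfl

lemma toC_mul [Fintype κ] (M : Matrix ι κ ℝ) (L : Matrix κ ν ℝ) :
    toC (M * L) = toC M * toC L :=
  Matrix.map_mul (f := Complex.ofRealHom)

lemma toC_add (M L : Matrix ι κ ℝ) : toC (M + L) = toC M + toC L := by
  ext; simp

lemma toC_sub (M L : Matrix ι κ ℝ) : toC (M - L) = toC M - toC L := by
  ext; simp

lemma toC_neg (M : Matrix ι κ ℝ) : toC (-M) = -toC M := by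
  ext; simp

@[simp] lemma toC_zero : toC (0 : Matrix ι κ ℝ) = 0 := by
  ext; simp

@[simp] lemma toC_one [DecidableEq ι] : toC (1 : Matrix ι ι ℝ) = 1 := by
  ext i j; simp [Matrix.one_apply, apply_ite]

lemma toC_smul (r : ℝ) (M : Matrix ι κ ℝ) : toC (r • M) = (r : ℂ) • toC M := by
  ext; simp

lemma toC_transpose (M : Matrix ι κ ℝ) : toC Mᵀ = (toC M)ᵀ := rfl

lemma toC_conjTranspose (M : Matrix ι κ ℝ) : toC Mᵀ = (toC M)ᴴ := by
  ext; simp [Matrix.conjTranspose_apply]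

variable [Fintype ι] [DecidableEq ι]

/-- Complexification of real square matrices as an `ℝ`-algebra homomorphism. -/
noncomputable def toCAlgHom (ι : Type*) [Fintype ι] [DecidableEq ι] :
    Matrix ι ι ℝ →ₐ[ℝ] Matrix ι ι ℂ :=
  Complex.ofRealAm.mapMatrix

lemma toCAlgHom_apply (M : Matrix ι ι ℝ) : toCAlgHom ι M = toC M := rfl

lemma toC_aeval (f : Polynomial ℝ) (M : Matrix ι ι ℝ) :
    toC (Polynomial.aeval M f) = Polynomial.aeval (toC M) (f.map (algebraMap ℝ ℂ)) := by
  rw [← toCAlgHom_apply, ← toCAlgHom_apply, Polynomial.aeval_map_algebraMap,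
    Polynomial.aeval_algHom_apply]

lemma charpoly_toC (M : Matrix ι ι ℝ) :
    (toC M).charpoly = M.charpoly.map (algebraMap ℝ ℂ) :=
  Matrix.charpoly_map M (algebraMap ℝ ℂ)

end ToC

/-! ### Eigenvalues and eigenvectors -/

section Eigenvectors

variable [Fintype ι] [DecidableEq ι]

lemma mem_spectrum_iff_exists_mulVec (M : Matrix ι ι ℂ) (μ : ℂ) :
    μ ∈ spectrum ℂ M ↔ ∃ v : ι → ℂ, v ≠ 0 ∧ M *ᵥ v = μ • v := by
  rw [← Matrix.spectrum_toLin', ← Module.End.hasEigenvalue_iff_mem_spectrum]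
  constructor
  · intro h
    obtain ⟨v, hv⟩ := h.exists_hasEigenvector
    exact ⟨v, hv.2, by simpa using hv.apply_eq_smul⟩
  · rintro ⟨v, h0, hv⟩
    exact Module.End.hasEigenvalue_of_hasEigenvector (x := v)
      ⟨Module.End.mem_eigenspace_iff.2 (by simpa using hv), h0⟩

lemma mem_eigs_iff (M : Matrix ι ι ℝ) (μ : ℂ) :
    μ ∈ eigs M ↔ ∃ v : ι → ℂ, v ≠ 0 ∧ toC M *ᵥ v = μ • v :=
  mem_spectrum_iff_exists_mulVec _ _

lemma mem_eigs_iff_aeval_charpoly (M : Matrix ι ι ℝ) (μ : ℂ) :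
    μ ∈ eigs M ↔ Polynomial.aeval μ M.charpoly = 0 := by
  rw [eigs, Matrix.mem_spectrum_iff_isRoot_charpoly, charpoly_toC, Polynomial.IsRoot,
    Polynomial.eval_map_algebraMap]

lemma eigs_transpose (M : Matrix ι ι ℝ) : eigs Mᵀ = eigs M := by
  ext μ
  rw [mem_eigs_iff_aeval_charpoly, mem_eigs_iff_aeval_charpoly, Matrix.charpoly_transpose]

/-- A nonzero invariant subspace of a complex matrix contains an eigenvector. -/
lemma exists_eigenvector_mem (M : Matrix ι ι ℂ) (p : Submodule ℂ (ι → ℂ)) (hp : p ≠ ⊥)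
    (hM : ∀ v ∈ p, M *ᵥ v ∈ p) :
    ∃ v ∈ p, v ≠ 0 ∧ ∃ μ : ℂ, M *ᵥ v = μ • v := by
  have : Nontrivial p := Submodule.nontrivial_iff_ne_bot.2 hp
  obtain ⟨μ, hμ⟩ := Module.End.exists_eigenvalue ((Matrix.toLin' M).restrict
    (p := p) (q := p) (by simpa using hM))
  obtain ⟨v, hv⟩ := hμ.exists_hasEigenvector
  refine ⟨v, v.2, fun h => hv.2 (Subtype.ext h), μ, ?_⟩
  simpa using congrArg Subtype.val hv.apply_eq_smul

lemma aeval_mulVec_eigenvector (M : Matrix ι ι ℂ) {v : ι → ℂ} {μ : ℂ} (hv : M *ᵥ v = μ • v)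
    (f : Polynomial ℂ) : Polynomial.aeval M f *ᵥ v = f.eval μ • v := by
  induction f using Polynomial.induction_on' with
  | add f g hf hg => simp [Matrix.add_mulVec, hf, hg, add_smul]
  | monomial k a =>
    have : ∀ k : ℕ, (M ^ k) *ᵥ v = μ ^ k • v := by
      intro k
      induction k with
      | zero => simp
      | succ k ih => rw [pow_succ, ← Matrix.mulVec_mulVec, hv, Matrix.mulVec_smul, ih, smul_smul,
          pow_succ, mul_comm]
    rw [Polynomial.aeval_monomial, Polynomial.eval_monomial, ← Algebra.smul_def, Matrix.smul_mulVec,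
      this, smul_smul]

end Eigenvectors

/-! ### The spectral projection onto the imaginary axis -/

section SpectralProjection

open Polynomial

/-- A nonzero real polynomial splits into a factor with all its roots on the imaginary axis and
a factor without roots there. The point is that an irreducible factor with a root on the
imaginary axis has all its roots there. -/
lemma exists_imaginary_axis_factorization (f : ℝ[X]) (hf : f ≠ 0) :
    ∃ g h : ℝ[X], f = g * h ∧ (∀ z : ℂ, aeval z g = 0 → z.re = 0) ∧
      (∀ z : ℂ, aeval z h = 0 → z.re ≠ 0) := by
  induction f using WfDvdMonoid.induction_on_irreducible with
  | zero => exact absurd rfl hf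
  | unit u hu =>
    refine ⟨1, u, by simp, by simp, fun z hz => ?_⟩
    obtain ⟨r, hr, rfl⟩ := Polynomial.isUnit_iff.1 hu
    simp [hr.ne_zero] at hz
  | mul a i ha hi ih =>
    obtain ⟨g, h, rfl, hg, hh⟩ := ih ha
    by_cases hz : ∃ z : ℂ, aeval z i = 0 ∧ z.re = 0
    · obtain ⟨z, hz, hz0⟩ := hz
      -- `z` is also a root of `X ^ 2 + |z| ^ 2`, which is therefore a multiple of `i`
      have hdvd : i ∣ X ^ 2 + C (z.im ^ 2) := by
        by_contra hnd
        obtain ⟨u, w, huw⟩ := (hi.coprime_iff_not_dvd).2 hnd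
        have h1 := congrArg (aeval z) huw
        have h2 : z ^ 2 + (z.im : ℂ) ^ 2 = 0 := by
          apply Complex.ext <;> simp [pow_two, hz0]
        simp [hz, h2] at h1
      refine ⟨i * g, h, by ring, fun w hw => ?_, hh⟩
      rw [map_mul, mul_eq_zero] at hw
      rcases hw with hw | hw
      · obtain ⟨u, hu⟩ := hdvd
        have h1 := congrArg (aeval w) hu
        simp only [map_add, map_pow, aeval_X, aeval_C, map_mul, hw, zero_mul] at h1
        have h2 := congrArg Complex.re h1
        have h3 := congrArg Complex.im h1
        simp [pow_two] at h2 h3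
        have h4 : w.re * w.im = 0 := by linarith
        rcases mul_eq_zero.1 h4 with h4 | h4
        · exact h4
        · rw [h4] at h2
          nlinarith [mul_self_nonneg w.re, mul_self_nonneg z.im]
      · exact hg w hw
    · refine ⟨g, i * h, by ring, hg, fun w hw => ?_⟩
      rw [map_mul, mul_eq_zero] at hw
      rcases hw with hw | hw
      · exact fun h0 => hz ⟨w, hw, h0⟩
      · exact hh w hw

variable [Fintype ι] [DecidableEq ι]

/-- The spectral projection of a real matrix onto the part with spectrum on the imaginary axis.
It is a real polynomial in the matrix. -/
lemma exists_imaginary_axis_projection (A : Matrix ι ι ℝ) :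
    ∃ q : ℝ[X], aeval A q * aeval A q = aeval A q ∧
      (∀ z ∈ eigs A, z.re = 0 → aeval z q = 1) ∧
      (∀ z ∈ eigs A, z.re ≠ 0 → aeval z q = 0) := by
  obtain ⟨g, h, hgh, hg, hh⟩ :=
    exists_imaginary_axis_factorization A.charpoly A.charpoly_monic.ne_zero
  have hco : IsCoprime g h := by
    rw [Polynomial.isCoprime_iff_aeval_ne_zero_of_isAlgClosed ℝ ℂ]
    intro z
    by_contra! hz
    exact hh z hz.2 (hg z hz.1)
  obtain ⟨u, w, huw⟩ := hco
  refine ⟨w * h, ?_, fun z hz h0 => ?_, fun z hz h0 => ?_⟩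
  · have h1 : (w * h) * (w * h) = w * h - (w * u) * A.charpoly := by
      have : w * h = 1 - u * g := by linear_combination huw
      calc (w * h) * (w * h) = (w * h) * (1 - u * g) := by rw [← this]
        _ = _ := by rw [hgh]; ring
    rw [← map_mul, h1, map_sub, map_mul _ _ A.charpoly, Matrix.aeval_self_charpoly, mul_zero,
      sub_zero]
  all_goals
    rw [mem_eigs_iff_aeval_charpoly, hgh, map_mul, mul_eq_zero] at hz
    have h1 := congrArg (aeval z) huw
    rw [map_add, map_mul, map_one] at h1
  · rw [hz.resolve_right (fun h => hh z h h0), mul_zero, zero_add] at h1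
    exact h1
  · rw [map_mul, hz.resolve_left (fun h => h0 (hg z h)), mul_zero]

lemma aeval_mulVec_real_eigenvector (A : Matrix ι ι ℝ) {v : ι → ℂ} {μ : ℂ}
    (hv : toC A *ᵥ v = μ • v) (f : ℝ[X]) : toC (aeval A f) *ᵥ v = aeval μ f • v := by
  rw [toC_aeval, aeval_mulVec_eigenvector _ hv, Polynomial.eval_map_algebraMap]

end SpectralProjection

/-! ### Matrix exponentials and the Lyapunov equation -/

section Exponential

open Filter NormedSpace

attribute [local instance] Matrix.linftyOpNormedRing Matrix.linftyOpNormedAlgebra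

/-- Powers of an element of spectral radius less than one tend to zero, by Gelfand's formula. -/
lemma tendsto_pow_atTop_nhds_zero_of_spectralRadius_lt_one {R : Type*} [NormedRing R]
    [NormedAlgebra ℂ R] [CompleteSpace R] {a : R} (ha : spectralRadius ℂ a < 1) :
    Tendsto (fun k : ℕ => a ^ k) atTop (𝓝 0) := by
  obtain ⟨r, hr, hr1⟩ := ENNReal.lt_iff_exists_nnreal_btwn.1 ha
  have hr1' : r < 1 := by exact_mod_cast hr1
  have h := (spectrum.pow_nnnorm_pow_one_div_tendsto_nhds_spectralRadius a).eventually_lt_const hr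
  refine squeeze_zero_norm' (a := fun k : ℕ => (r : ℝ) ^ k) ?_
    (tendsto_pow_atTop_nhds_zero_of_lt_one r.2 (by exact_mod_cast hr1'))
  filter_upwards [h, eventually_gt_atTop 0] with k hk hk0
  have h1 := ENNReal.rpow_le_rpow hk.le (z := (k : ℝ)) (by positivity)
  rw [← ENNReal.rpow_mul, one_div, inv_mul_cancel₀ (by positivity), ENNReal.rpow_one,
    ENNReal.rpow_natCast] at h1
  exact_mod_cast h1

variable [Fintype ι] [DecidableEq ι]

/-- The eigenvalues of `exp M` are exponentials of eigenvalues of `M`: an eigenspace of `exp M`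
is invariant under `M`. -/
lemma exists_exp_eq_of_mem_spectrum_exp (M : Matrix ι ι ℂ) {z : ℂ}
    (hz : z ∈ spectrum ℂ (exp M)) : ∃ μ ∈ spectrum ℂ M, z = Complex.exp μ := by
  obtain ⟨v, hv0, hv⟩ := (mem_spectrum_iff_exists_mulVec _ _).1 hz
  have hcomm : exp M * M = M * exp M := ((Commute.refl M).exp_left).eq
  obtain ⟨w, hw, hw0, μ, hμ⟩ := exists_eigenvector_mem M
    (LinearMap.ker (Matrix.toLin' (exp M) - z • LinearMap.id))
    (by
      intro h
      apply hv0
      rw [← Submodule.mem_bot ℂ, ← h]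
      simp [hv])
    (by
      intro u hu
      simp only [LinearMap.mem_ker, LinearMap.sub_apply, Matrix.toLin'_apply, LinearMap.smul_apply,
        LinearMap.id_apply, sub_eq_zero] at hu ⊢
      rw [Matrix.mulVec_mulVec, hcomm, ← Matrix.mulVec_mulVec, hu, Matrix.mulVec_smul])
  refine ⟨μ, (mem_spectrum_iff_exists_mulVec _ _).2 ⟨w, hw0, hμ⟩, ?_⟩
  simp only [LinearMap.mem_ker, LinearMap.sub_apply, Matrix.toLin'_apply, LinearMap.smul_apply,
    LinearMap.id_apply, sub_eq_zero] at hw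
  have hpow : ∀ k : ℕ, (M ^ k) *ᵥ w = μ ^ k • w := fun k => by
    simpa using aeval_mulVec_eigenvector M hμ (Polynomial.X ^ k)
  have h1 : HasSum (fun k : ℕ => ((k.factorial : ℂ)⁻¹ • M ^ k) *ᵥ w) (exp M *ᵥ w) := by
    have := exp_series_hasSum_exp' (𝕂 := ℂ) M
    exact this.map ((Matrix.mulVecBilin ℂ ℂ).flip w).toAddMonoidHom
      (LinearMap.continuous_of_finiteDimensional ((Matrix.mulVecBilin ℂ ℂ).flip w))
  have h2 : HasSum (fun k : ℕ => ((k.factorial : ℂ)⁻¹ • M ^ k) *ᵥ w) (Complex.exp μ • w) := by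
    have := (exp_series_hasSum_exp' (𝕂 := ℂ) μ).smul_const w
    rw [← Complex.exp_eq_exp_ℂ] at this
    simpa [Matrix.smul_mulVec, hpow, smul_smul] using this
  have h3 := h1.unique h2
  rw [hw] at h3
  exact smul_left_injective ℂ hw0 h3

lemma toC_exp (M : Matrix ι ι ℝ) : toC (exp M) = exp (toC M) := by
  refine map_exp (f := (toCAlgHom ι : Matrix ι ι ℝ →+* Matrix ι ι ℂ)) ?_ M
  exact LinearMap.continuous_of_finiteDimensional (toCAlgHom ι).toLinearMap

lemma hasDerivAt_exp_smul_apply (M : Matrix ι ι ℝ) (t : ℝ) (i j : ι) :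
    HasDerivAt (fun u : ℝ => exp (u • M) i j) ((M * exp (t • M)) i j) t := by
  have h := hasDerivAt_exp_smul_const' (𝕂 := ℝ) M t
  exact hasDerivAt_pi.1 (hasDerivAt_pi.1 h i) j

lemma exp_zero_smul (M : Matrix ι ι ℝ) : exp ((0 : ℝ) • M) = 1 := by
  rw [zero_smul, exp_zero]

/-- Exponential stability of Hurwitz matrices, in the weak form that is needed here. -/
lemma IsHurwitz.tendsto_exp_smul {M : Matrix ι ι ℝ} (hM : IsHurwitz M) :
    Tendsto (fun t : ℝ => exp (t • M)) atTop (𝓝 0) := by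
  rcases isEmpty_or_nonempty ι with hι | hι
  · exact tendsto_const_nhds.congr fun t => Subsingleton.elim _ _
  have hrad : spectralRadius ℂ (toC (exp M)) < 1 := by
    refine spectrum.spectralRadius_lt_of_forall_lt _ (r := 1) fun z hz => ?_
    rw [toC_exp] at hz
    obtain ⟨μ, hμ, rfl⟩ := exists_exp_eq_of_mem_spectrum_exp _ hz
    rw [← NNReal.coe_lt_coe, coe_nnnorm, Complex.norm_exp, NNReal.coe_one, Real.exp_lt_one_iff]
    exact hM μ hμ
  have hpow : Tendsto (fun k : ℕ => (exp M) ^ k) atTop (𝓝 0) := by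
    have h1 := tendsto_pow_atTop_nhds_zero_of_spectralRadius_lt_one hrad
    refine tendsto_pi_nhds.2 fun i => tendsto_pi_nhds.2 fun j => ?_
    have h2 := tendsto_pi_nhds.1 (tendsto_pi_nhds.1 h1 i) j
    have h3 := (Complex.continuous_re.tendsto _).comp h2
    refine h3.congr fun k => ?_
    simp only [Function.comp_apply]
    rw [← toCAlgHom_apply, ← map_pow, toCAlgHom_apply, toC_apply, Complex.ofReal_re]
  obtain ⟨c, hc⟩ := (isCompact_Icc (a := (0 : ℝ)) (b := 1)).exists_bound_of_continuousOn
    (f := fun t : ℝ => exp (t • M))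
    (differentiable_exp_smul_const ℝ M).continuous.continuousOn
  refine squeeze_zero_norm' (a := fun t : ℝ => ‖exp M ^ ⌊t⌋₊‖ * c) ?_ ?_
  · filter_upwards [eventually_ge_atTop 0] with t ht
    have h1 : exp (t • M) = exp M ^ ⌊t⌋₊ * exp ((t - ⌊t⌋₊) • M) := by
      rw [← Matrix.exp_nsmul, ← Matrix.exp_add_of_commute, ← Nat.cast_smul_eq_nsmul ℝ, ← add_smul,
        add_sub_cancel]
      exact ((Commute.refl M).smul_left _).smul_right _
    rw [h1]
    refine (norm_mul_le _ _).trans (mul_le_mul_of_nonneg_left (hc _ ⟨?_, ?_⟩) (norm_nonneg _))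
    · exact sub_nonneg.2 (Nat.floor_le ht)
    · linarith [Nat.lt_floor_add_one t]
  · have h1 := (hpow.norm.comp (tendsto_nat_floor_atTop (α := ℝ))).mul_const c
    simpa using h1

section Lyapunov

variable {M X Z : Matrix ι ι ℝ}

lemma hasDerivAt_exp_mul_mul_exp_transpose (hX : M * X + X * Mᵀ = -Z) (t : ℝ) :
    HasDerivAt (fun u : ℝ => exp (u • M) * X * (exp (u • M))ᵀ)
      (-(exp (t • M) * Z * (exp (t • M))ᵀ)) t := by
  have h1 := (hasDerivAt_exp_smul_const (𝕂 := ℝ) M t).mul_const X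
  have h3 : ∀ u : ℝ, exp (u • Mᵀ) = (exp (u • M))ᵀ := fun u => by
    rw [← Matrix.exp_transpose, Matrix.transpose_smul]
  have h4 : HasDerivAt (fun u : ℝ => (exp (u • M))ᵀ) (Mᵀ * (exp (t • M))ᵀ) t := by
    rw [← h3 t]
    exact (hasDerivAt_exp_smul_const' (𝕂 := ℝ) Mᵀ t).congr_of_eventuallyEq
      (.of_forall fun u => (h3 u).symm)
  have h2 := h1.mul h4
  convert! h2 using 1
  rw [eq_neg_iff_add_eq_zero.1 hX |> eq_neg_of_add_eq_zero_right]
  simp only [mul_add, add_mul, mul_assoc, neg_add_rev, neg_neg, mul_neg, neg_mul]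
  abel

lemma IsHurwitz.tendsto_exp_mul_mul_exp_transpose (hM : IsHurwitz M) (X : Matrix ι ι ℝ) :
    Tendsto (fun u : ℝ => exp (u • M) * X * (exp (u • M))ᵀ) atTop (𝓝 0) := by
  have h := hM.tendsto_exp_smul
  have h2 : Tendsto (fun u : ℝ => (exp (u • M))ᵀ) atTop (𝓝 0) := by
    have := (continuous_id.matrix_transpose.tendsto (0 : Matrix ι ι ℝ)).comp h
    simpa [Function.comp_def] using this
  simpa using (h.mul_const X).mul h2

/-- Solutions of the Lyapunov equation of a Hurwitz matrix are unique. -/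
lemma IsHurwitz.lyapunov_unique (hM : IsHurwitz M) (hX : M * X + X * Mᵀ = 0) : X = 0 := by
  have hX' : M * X + X * Mᵀ = -0 := by rw [hX, neg_zero]
  have h1 : ∀ t : ℝ, exp (t • M) * X * (exp (t • M))ᵀ = X := by
    intro t
    have h := is_const_of_deriv_eq_zero (𝕜 := ℝ)
      (f := fun u : ℝ => exp (u • M) * X * (exp (u • M))ᵀ)
      (fun u => (hasDerivAt_exp_mul_mul_exp_transpose hX' u).differentiableAt)
      (fun u => by rw [(hasDerivAt_exp_mul_mul_exp_transpose hX' u).deriv]; simp) t 0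
    simpa [exp_zero_smul] using h
  have h2 := hM.tendsto_exp_mul_mul_exp_transpose X
  simp only [h1] at h2
  exact tendsto_nhds_unique tendsto_const_nhds h2

lemma IsHurwitz.exists_lyapunov (hM : IsHurwitz M) (Z : Matrix ι ι ℝ) :
    ∃ X : Matrix ι ι ℝ, M * X + X * Mᵀ = -Z := by
  let T : Matrix ι ι ℝ →ₗ[ℝ] Matrix ι ι ℝ := LinearMap.mulLeft ℝ M + LinearMap.mulRight ℝ Mᵀ
  have hT : ∀ X, T X = M * X + X * Mᵀ := fun X => rfl
  have hinj : Function.Injective T := by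
    rw [← LinearMap.ker_eq_bot, LinearMap.ker_eq_bot']
    exact fun X hX => hM.lyapunov_unique hX
  exact LinearMap.surjective_of_injective hinj (-Z)

lemma IsHurwitz.lyapunov_isSymm (hM : IsHurwitz M) (hX : M * X + X * Mᵀ = -Z) (hZ : Zᵀ = Z) :
    Xᵀ = X := by
  rw [← sub_eq_zero]
  apply hM.lyapunov_unique
  have h1 := congrArg Matrix.transpose hX
  simp only [Matrix.transpose_add, Matrix.transpose_mul, Matrix.transpose_transpose,
    Matrix.transpose_neg, hZ] at h1
  rw [mul_sub, sub_mul]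
  calc _ = (X * Mᵀ)ᵀ * 1 + 0 - (M * X + X * Mᵀ) + Xᵀ * Mᵀ := by
        simp; abel
    _ = 0 := by
      rw [hX, ← h1]; simp

/-- The solution of the Lyapunov equation is positive semidefinite because
`xᵀ exp(tM) X exp(tM)ᵀ x` is antitone in `t` with limit `0`. -/
lemma IsHurwitz.lyapunov_posSemidef (hM : IsHurwitz M) (hX : M * X + X * Mᵀ = -Z)
    (hZ : Z.PosSemidef) : X.PosSemidef := by
  have hZs : Zᵀ = Z := by
    simpa only [Matrix.conjTranspose_eq_transpose_of_trivial] using hZ.isHermitian.eq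
  refine Matrix.PosSemidef.of_dotProduct_mulVec_nonneg
    (by
      rw [Matrix.IsHermitian, Matrix.conjTranspose_eq_transpose_of_trivial]
      exact hM.lyapunov_isSymm hX hZs)
    fun x => ?_
  let T : Matrix ι ι ℝ →L[ℝ] ℝ := LinearMap.toContinuousLinearMap
    ((dotProductBilin ℝ ℝ x) ∘ₗ ((Matrix.mulVecBilin ℝ ℝ).flip x))
  have hT : ∀ Y : Matrix ι ι ℝ, T Y = x ⬝ᵥ Y *ᵥ x := fun Y => rfl
  have hder : ∀ t, HasDerivAt (fun u : ℝ => T (exp (u • M) * X * (exp (u • M))ᵀ))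
      (T (-(exp (t • M) * Z * (exp (t • M))ᵀ))) t := fun t =>
    T.hasFDerivAt.comp_hasDerivAt t (hasDerivAt_exp_mul_mul_exp_transpose hX t)
  have hanti : Antitone (fun u : ℝ => T (exp (u • M) * X * (exp (u • M))ᵀ)) := by
    refine antitone_of_hasDerivAt_nonpos hder fun t => ?_
    rw [map_neg, hT, Pi.zero_apply, neg_nonpos]
    have := (hZ.mul_mul_conjTranspose_same (exp (t • M))).dotProduct_mulVec_nonneg x
    simpa [Matrix.conjTranspose_eq_transpose_of_trivial] using this
  have hlim := (T.continuous.tendsto 0).comp (hM.tendsto_exp_mul_mul_exp_transpose X)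
  have h0 := hanti.le_of_tendsto hlim 0
  simpa [exp_zero_smul, hT] using h0

end Lyapunov

end Exponential

/-! ### Hermitian forms of real matrices -/

section Forms

variable [Fintype ι] [Fintype κ] [Fintype ν]

/-- The sesquilinear form `x* P y` on complex vectors given by a real matrix `P`. -/
noncomputable def hform (P : Matrix ι κ ℝ) (x : ι → ℂ) (y : κ → ℂ) : ℂ :=
  star x ⬝ᵥ (toC P *ᵥ y)

/-- The real part of the quadratic form `x* P x` on complex vectors. For symmetric `P` the form is
already real. -/
noncomputable def qform (P : Matrix ι ι ℝ) (x : ι → ℂ) : ℝ := (hform P x x).re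

lemma hform_mulVec_right (P : Matrix ι κ ℝ) (L : Matrix κ ν ℝ) (x : ι → ℂ) (y : ν → ℂ) :
    hform P x (toC L *ᵥ y) = hform (P * L) x y := by
  rw [hform, hform, toC_mul, Matrix.mulVec_mulVec]

lemma hform_mulVec_left (P : Matrix ι κ ℝ) (L : Matrix ι ν ℝ) (x : ν → ℂ) (y : κ → ℂ) :
    hform P (toC L *ᵥ x) y = hform (Lᵀ * P) x y := by
  rw [hform, hform, toC_mul, ← Matrix.mulVec_mulVec, Matrix.star_mulVec, Matrix.dotProduct_mulVec,
    Matrix.dotProduct_mulVec, Matrix.dotProduct_mulVec, toC_conjTranspose]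

lemma qform_mulVec (P : Matrix ι ι ℝ) (L : Matrix ι ν ℝ) (x : ν → ℂ) :
    qform P (toC L *ᵥ x) = qform (Lᵀ * P * L) x := by
  rw [qform, hform_mulVec_right, hform_mulVec_left, Matrix.mul_assoc, qform]

lemma hform_add_right (P : Matrix ι κ ℝ) (x : ι → ℂ) (y z : κ → ℂ) :
    hform P x (y + z) = hform P x y + hform P x z := by
  simp [hform, Matrix.mulVec_add]

lemma hform_sub_right (P : Matrix ι κ ℝ) (x : ι → ℂ) (y z : κ → ℂ) :
    hform P x (y - z) = hform P x y - hform P x z := by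
  simp [hform, Matrix.mulVec_sub]

lemma hform_smul_right (P : Matrix ι κ ℝ) (x : ι → ℂ) (r : ℂ) (y : κ → ℂ) :
    hform P x (r • y) = r * hform P x y := by
  simp [hform, Matrix.mulVec_smul]

lemma hform_add_matrix (P R : Matrix ι κ ℝ) (x : ι → ℂ) (y : κ → ℂ) :
    hform (P + R) x y = hform P x y + hform R x y := by
  simp [hform, toC_add, Matrix.add_mulVec]

lemma hform_neg_matrix (P : Matrix ι κ ℝ) (x : ι → ℂ) (y : κ → ℂ) :
    hform (-P) x y = -hform P x y := by
  simp [hform, toC_neg, Matrix.neg_mulVec]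

lemma hform_smul_matrix (r : ℝ) (P : Matrix ι κ ℝ) (x : ι → ℂ) (y : κ → ℂ) :
    hform (r • P) x y = r * hform P x y := by
  simp [hform, toC_smul, Matrix.smul_mulVec]

lemma star_hform (P : Matrix ι κ ℝ) (x : ι → ℂ) (y : κ → ℂ) :
    star (hform P x y) = hform Pᵀ y x := by
  rw [hform, hform, ← Matrix.star_dotProduct, Matrix.star_mulVec, ← toC_conjTranspose,
    Matrix.dotProduct_mulVec, dotProduct_comm]

lemma qform_add_matrix (P R : Matrix ι ι ℝ) (x : ι → ℂ) :
    qform (P + R) x = qform P x + qform R x := by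
  simp [qform, hform_add_matrix]

lemma qform_neg_matrix (P : Matrix ι ι ℝ) (x : ι → ℂ) : qform (-P) x = -qform P x := by
  simp [qform, hform_neg_matrix]

lemma qform_smul_matrix (r : ℝ) (P : Matrix ι ι ℝ) (x : ι → ℂ) :
    qform (r • P) x = r * qform P x := by
  simp [qform, hform_smul_matrix]

lemma qform_smul (P : Matrix ι ι ℝ) (r : ℂ) (x : ι → ℂ) :
    qform P (r • x) = ‖r‖ ^ 2 * qform P x := by
  rw [qform, hform_smul_right, hform, star_smul, smul_dotProduct, smul_eq_mul, ← mul_assoc,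
    ← starRingEnd_apply, Complex.mul_conj, Complex.normSq_eq_norm_sq, Complex.re_ofReal_mul]
  rfl

lemma qform_one [DecidableEq ι] (x : ι → ℂ) : qform 1 x = ∑ i, ‖x i‖ ^ 2 := by
  simp only [qform, hform, toC_one, Matrix.one_mulVec, dotProduct, Pi.star_apply, Complex.re_sum]
  refine Finset.sum_congr rfl fun i _ => ?_
  rw [mul_comm, ← starRingEnd_apply, Complex.mul_conj, Complex.normSq_eq_norm_sq,
    Complex.ofReal_re]

lemma qform_one_nonneg [DecidableEq ι] (x : ι → ℂ) : 0 ≤ qform 1 x := by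
  rw [qform_one]; positivity

lemma qform_one_eq_zero [DecidableEq ι] {x : ι → ℂ} (h : qform 1 x = 0) : x = 0 := by
  rw [qform_one, Finset.sum_eq_zero_iff_of_nonneg (fun _ _ => by positivity)] at h
  ext i
  simpa using h i (Finset.mem_univ i)

open scoped MatrixOrder Matrix.Norms.L2Operator in
lemma exists_eq_transpose_mul_self [DecidableEq ι] {P : Matrix ι ι ℝ} (hP : P.PosSemidef) :
    ∃ T : Matrix ι ι ℝ, P = Tᵀ * T := by
  obtain ⟨T, hT⟩ := CStarAlgebra.nonneg_iff_eq_star_mul_self.1 hP.nonneg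
  rw [Matrix.star_eq_conjTranspose] at hT
  exact ⟨T, by rw [hT, Matrix.conjTranspose_eq_transpose_of_trivial]⟩

lemma transpose_eq_of_posSemidef {ι : Type*} {P : Matrix ι ι ℝ} (hP : P.PosSemidef) : Pᵀ = P := by
  rw [← Matrix.conjTranspose_eq_transpose_of_trivial]
  exact hP.isHermitian.eq

lemma qform_transpose_mul_self (T : Matrix κ ι ℝ) [DecidableEq κ] (x : ι → ℂ) :
    qform (Tᵀ * T) x = qform 1 (toC T *ᵥ x) := by
  rw [qform_mulVec, Matrix.mul_one]

lemma qform_nonneg [DecidableEq ι] {P : Matrix ι ι ℝ} (hP : P.PosSemidef) (x : ι → ℂ) :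
    0 ≤ qform P x := by
  obtain ⟨T, rfl⟩ := exists_eq_transpose_mul_self hP
  rw [qform_transpose_mul_self]
  exact qform_one_nonneg _

lemma hform_self_eq_qform {P : Matrix ι ι ℝ} (hP : Pᵀ = P) (x : ι → ℂ) :
    hform P x x = qform P x := by
  have h := star_hform P x x
  rw [hP] at h
  exact (Complex.conj_eq_iff_re.1 h).symm

/-- The Cauchy–Schwarz inequality for a positive semidefinite form. -/
lemma norm_hform_sq_le [DecidableEq ι] {P : Matrix ι ι ℝ} (hP : P.PosSemidef) (x y : ι → ℂ) :
    ‖hform P x y‖ ^ 2 ≤ qform P x * qform P y := by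
  obtain ⟨T, rfl⟩ := exists_eq_transpose_mul_self hP
  have key : ∀ u v : ι → ℂ, hform (Tᵀ * T) u v =
      inner ℂ (WithLp.toLp 2 (toC T *ᵥ u)) (WithLp.toLp 2 (toC T *ᵥ v)) := by
    intro u v
    rw [EuclideanSpace.inner_eq_star_dotProduct, dotProduct_comm, ← hform_mulVec_right]
    rw [← Matrix.mul_one Tᵀ, ← hform_mulVec_left, hform, toC_one, Matrix.one_mulVec]
  have h := norm_inner_le_norm (𝕜 := ℂ) (WithLp.toLp 2 (toC T *ᵥ x)) (WithLp.toLp 2 (toC T *ᵥ y))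
  have hn : ∀ u : ι → ℂ, qform (Tᵀ * T) u = ‖WithLp.toLp 2 (toC T *ᵥ u)‖ ^ 2 := fun u => by
    rw [qform, key, inner_self_eq_norm_sq_to_K]
    norm_cast
  rw [hn, hn, key, ← mul_pow]
  gcongr

/-- A positive semidefinite matrix is at most its trace. -/
lemma qform_le_trace_mul [DecidableEq ι] {P : Matrix ι ι ℝ} (hP : P.PosSemidef) (x : ι → ℂ) :
    qform P x ≤ P.trace * qform 1 x := by
  obtain ⟨T, rfl⟩ := exists_eq_transpose_mul_self hP
  rw [qform_transpose_mul_self, qform_one, qform_one]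
  have htr : (Tᵀ * T).trace = ∑ i, ∑ j, T i j ^ 2 := by
    rw [Finset.sum_comm]
    simp [Matrix.trace, Matrix.mul_apply, pow_two]
  rw [htr, Finset.sum_mul]
  refine Finset.sum_le_sum fun i _ => ?_
  have h1 : ‖(toC T *ᵥ x) i‖ ≤ ∑ j, |T i j| * ‖x j‖ := by
    refine (norm_sum_le _ _).trans (le_of_eq ?_)
    simp
  calc ‖(toC T *ᵥ x) i‖ ^ 2 ≤ (∑ j, |T i j| * ‖x j‖) ^ 2 := by gcongr
    _ ≤ (∑ j, |T i j| ^ 2) * ∑ j, ‖x j‖ ^ 2 := Finset.sum_mul_sq_le_sq_mul_sq _ _ _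
    _ = _ := by simp

end Forms

/-! ### The parametric Riccati equation -/

section Riccati

variable [Fintype ι] [DecidableEq ι] [Fintype κ]

/-- The trace of a real matrix is the sum of its complex eigenvalues. -/
lemma trace_eq_zero_of_eigs_imaginary {A : Matrix ι ι ℝ} (hA : ∀ z ∈ eigs A, z.re = 0) :
    A.trace = 0 := by
  have h1 : (toC A).trace = (A.trace : ℂ) := by
    simp [Matrix.trace]
  have h2 := Matrix.trace_eq_sum_roots_charpoly (toC A)
  rw [h1] at h2
  have h3 := congrArg Complex.reAddGroupHom h2
  rw [map_multiset_sum] at h3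
  refine h3.trans (Multiset.sum_eq_zero fun r hr => ?_)
  obtain ⟨z, hz, rfl⟩ := Multiset.mem_map.1 hr
  refine hA z ?_
  rw [eigs, Matrix.mem_spectrum_iff_isRoot_charpoly]
  exact Polynomial.isRoot_of_mem_roots hz

omit [DecidableEq ι] in
lemma qform_mul_transpose (T : Matrix ι κ ℝ) [DecidableEq κ] (x : ι → ℂ) :
    qform (T * Tᵀ) x = qform 1 (toC Tᵀ *ᵥ x) := by
  rw [← qform_transpose_mul_self, Matrix.transpose_transpose]

omit [DecidableEq ι] in
lemma posSemidef_mul_transpose (T : Matrix ι κ ℝ) : (T * Tᵀ).PosSemidef := by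
  have := Matrix.posSemidef_self_mul_conjTranspose T
  rwa [Matrix.conjTranspose_eq_transpose_of_trivial] at this

lemma isUnit_of_toC_mulVec_injective {W : Matrix ι ι ℝ}
    (hW : ∀ v : ι → ℂ, toC W *ᵥ v = 0 → v = 0) : IsUnit W := by
  rw [Matrix.isUnit_iff_isUnit_det, isUnit_iff_ne_zero]
  intro h0
  obtain ⟨v, hv, hWv⟩ := Matrix.exists_mulVec_eq_zero_iff.2 h0
  apply hv
  have h1 := hW (fun i => (v i : ℂ)) (by
    ext i
    have := congrFun hWv i
    simp only [Matrix.mulVec, dotProduct, Pi.zero_apply, toC_apply] at this ⊢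
    exact_mod_cast this)
  ext i
  simpa using congrFun h1 i

/-- The Gramian of a controllable pair is invertible. Its kernel is invariant under the transposed
state matrix, so that a nonzero kernel would contain an eigenvector annihilated by the input
matrix. -/
lemma gramian_isUnit {M W Z : Matrix ι ι ℝ} (hW : M * W + W * Mᵀ = -Z) (hWs : Wᵀ = W)
    (hZ : Z.PosSemidef)
    (hctrl : ∀ (μ : ℂ) (v : ι → ℂ), toC Mᵀ *ᵥ v = μ • v → qform Z v = 0 → v = 0) :
    IsUnit W := by
  have hker : ∀ v : ι → ℂ, toC W *ᵥ v = 0 → qform Z v = 0 := by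
    intro v hv
    have h1 : qform (-Z) v = 0 := by
      rw [← hW, qform_add_matrix, qform, qform, ← hform_mulVec_right, hv, ← hWs,
        ← hform_mulVec_left, hv]
      simp [hform]
    rwa [qform_neg_matrix, neg_eq_zero] at h1
  have hinv : ∀ v : ι → ℂ, toC W *ᵥ v = 0 → toC W *ᵥ (toC Mᵀ *ᵥ v) = 0 := by
    intro v hv
    have h1 : toC Z *ᵥ v = 0 := by
      -- the zero set of a positive semidefinite form is its kernel
      obtain ⟨T, rfl⟩ := exists_eq_transpose_mul_self hZ
      have h2 := hker v hv
      rw [qform_transpose_mul_self] at h2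
      rw [toC_mul, ← Matrix.mulVec_mulVec, qform_one_eq_zero h2, Matrix.mulVec_zero]
    have h2 := congrArg (fun Y => toC Y *ᵥ v) hW
    simp only [toC_add, toC_mul, toC_neg, Matrix.add_mulVec, Matrix.neg_mulVec, h1,
      ← Matrix.mulVec_mulVec, hv, Matrix.mulVec_zero, zero_add, neg_zero] at h2
    exact h2
  apply isUnit_of_toC_mulVec_injective
  by_contra! hne
  obtain ⟨v, hv, hv0⟩ := hne
  obtain ⟨w, hw, hw0, μ, hμ⟩ := exists_eigenvector_mem (toC Mᵀ)
    (LinearMap.ker (Matrix.toLin' (toC W)))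
    (by
      intro h
      apply hv0
      rw [← Submodule.mem_bot ℂ, ← h]
      simpa using hv)
    (fun u hu => by simpa using hinv u (by simpa using hu))
  exact hw0 (hctrl μ w hμ (hker w (by simpa using hw)))

/-- The parametric Riccati equation. Let `Q` be a projection commuting with `A` such that `A Q`
has its spectrum on the imaginary axis, and suppose that `(A, B)` is controllable on the
corresponding modes. Then the Riccati equation has a positive semidefinite solution `P` that
controls the range of `Q`, and `tr (Bᵀ P B)` is of order `ε`.

On the range of `Q` the matrix `P` is the inverse of the Gramian of `-(A + ε / 2)`. On the whole
space, this is obtained by replacing `A` with `A Q` and adding `1 - Q` as a fictitious input. -/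
lemma exists_parametric_riccati {A Q : Matrix ι ι ℝ} {B : Matrix ι κ ℝ} (hQ : Q * Q = Q)
    (hAQ : A * Q = Q * A) (him : ∀ z ∈ eigs (A * Q), z.re = 0)
    (hctrl : ∀ (μ : ℂ) (v : ι → ℂ), toC Aᵀ *ᵥ v = μ • v → toC Qᵀ *ᵥ v = v →
      toC Bᵀ *ᵥ v = 0 → v = 0) {ε : ℝ} (hε : 0 < ε) :
    ∃ P : Matrix ι ι ℝ, P.PosSemidef ∧ Aᵀ * P + P * A + ε • P = P * B * Bᵀ * P ∧
      (Bᵀ * P * B).trace ≤ Fintype.card ι * ε ∧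
      ∃ c : ℝ, 0 ≤ c ∧ ∀ x : ι → ℂ, qform 1 (toC Q *ᵥ x) ≤ c * qform P x := by
  classical
  set M : Matrix ι ι ℝ := -(A * Q + (ε / 2) • 1) with hM
  set Z : Matrix ι ι ℝ := (Q * B) * (Q * B)ᵀ + (1 - Q) * (1 - Q)ᵀ with hZ
  have hMH : IsHurwitz M := by
    intro μ hμ
    obtain ⟨v, hv0, hv⟩ := (mem_eigs_iff _ _).1 hμ
    have h1 : toC (A * Q) *ᵥ v = (-μ - (ε / 2 : ℝ)) • v := by
      rw [hM, toC_neg, toC_add, toC_smul, toC_one, Matrix.neg_mulVec, Matrix.add_mulVec,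
        Matrix.smul_mulVec, Matrix.one_mulVec] at hv
      rw [sub_smul, neg_smul, ← hv]
      abel
    have h2 := him _ ((mem_eigs_iff _ _).2 ⟨v, hv0, h1⟩)
    simp only [Complex.sub_re, Complex.neg_re, Complex.ofReal_re] at h2
    linarith
  have hZp : Z.PosSemidef := (posSemidef_mul_transpose _).add (posSemidef_mul_transpose _)
  obtain ⟨W, hW⟩ := hMH.exists_lyapunov Z
  have hWs := hMH.lyapunov_isSymm hW (transpose_eq_of_posSemidef hZp)
  have hWp := hMH.lyapunov_posSemidef hW hZp
  have hQAT : Qᵀ * Aᵀ = Aᵀ * Qᵀ := by rw [← Matrix.transpose_mul, hAQ, Matrix.transpose_mul]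
  have hQT : Qᵀ * Qᵀ = Qᵀ := by rw [← Matrix.transpose_mul, hQ]
  have hWu : IsUnit W := by
    refine gramian_isUnit hW hWs hZp fun μ v hv h0 => ?_
    rw [hZ, qform_add_matrix, qform_mul_transpose, qform_mul_transpose] at h0
    have h1 := qform_one_nonneg (toC (Q * B)ᵀ *ᵥ v)
    have h2 := qform_one_nonneg (toC (1 - Q)ᵀ *ᵥ v)
    have h3 := qform_one_eq_zero (le_antisymm (by linarith) h1)
    have h4 := qform_one_eq_zero (le_antisymm (by linarith) h2)
    have h5 : toC Qᵀ *ᵥ v = v := by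
      rw [Matrix.transpose_sub, Matrix.transpose_one, toC_sub, toC_one, Matrix.sub_mulVec,
        Matrix.one_mulVec, sub_eq_zero] at h4
      exact h4.symm
    rw [Matrix.transpose_mul, toC_mul, ← Matrix.mulVec_mulVec, h5] at h3
    refine hctrl (-μ - (ε / 2 : ℝ)) v ?_ h5 h3
    rw [hM, Matrix.transpose_neg, Matrix.transpose_add, Matrix.transpose_mul,
      Matrix.transpose_smul, Matrix.transpose_one, toC_neg, toC_add, toC_smul, toC_one,
      Matrix.neg_mulVec, Matrix.add_mulVec, Matrix.smul_mulVec, Matrix.one_mulVec, hQAT,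
      toC_mul, ← Matrix.mulVec_mulVec, h5] at hv
    rw [sub_smul, neg_smul, ← hv]
    abel
  -- the Gramian respects the decomposition given by `Q`
  have hWQ : Q * W = W * Qᵀ := by
    rw [← sub_eq_zero]
    apply hMH.lyapunov_unique
    have hQM : M * Q = Q * M := by
      rw [hM]
      simp only [neg_mul, mul_neg, add_mul, mul_add, smul_mul_assoc, mul_smul_comm, one_mul,
        mul_one, mul_assoc, hQ]
      rw [hAQ, ← mul_assoc, hQ]
    have hMQT : Mᵀ * Qᵀ = Qᵀ * Mᵀ := by
      rw [← Matrix.transpose_mul, ← hQM, Matrix.transpose_mul]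
    have hQZ : Q * Z = Z * Qᵀ := by
      have e1 : Q * (Q * B) = Q * B := by rw [← Matrix.mul_assoc, hQ]
      have e2 : (Q * B)ᵀ * Qᵀ = (Q * B)ᵀ := by rw [← Matrix.transpose_mul, e1]
      have e3 : Q * (1 - Q) = 0 := by rw [mul_sub, mul_one, hQ, sub_self]
      have e4 : (1 - Q)ᵀ * Qᵀ = 0 := by rw [← Matrix.transpose_mul, e3, Matrix.transpose_zero]
      rw [hZ, mul_add, add_mul, ← Matrix.mul_assoc Q, e1, Matrix.mul_assoc (Q * B), e2,
        ← Matrix.mul_assoc Q, e3, Matrix.mul_assoc (1 - Q), e4, zero_mul, mul_zero]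
    calc M * (Q * W - W * Qᵀ) + (Q * W - W * Qᵀ) * Mᵀ
        = Q * (M * W + W * Mᵀ) - (M * W + W * Mᵀ) * Qᵀ := by
          rw [mul_sub, sub_mul, mul_add, add_mul, ← mul_assoc M, hQM, mul_assoc W Mᵀ, hMQT]
          simp only [mul_assoc]
          abel
      _ = 0 := by rw [hW, mul_neg, neg_mul, hQZ, sub_self]
  set P₀ : Matrix ι ι ℝ := W⁻¹ with hP₀
  have hdet : IsUnit W.det := (Matrix.isUnit_iff_isUnit_det _).1 hWu
  have hPW : P₀ * W = 1 := Matrix.nonsing_inv_mul _ hdet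
  have hWP : W * P₀ = 1 := Matrix.mul_nonsing_inv _ hdet
  have hP₀p : P₀.PosSemidef := hWp.inv
  have hPQ : P₀ * Q = Qᵀ * P₀ := by
    calc P₀ * Q = P₀ * (Q * W) * P₀ := by rw [mul_assoc, mul_assoc, hWP, mul_one]
      _ = Qᵀ * P₀ := by rw [hWQ, ← mul_assoc, hPW, one_mul]
  have hARE : (A * Q)ᵀ * P₀ + P₀ * (A * Q) + ε • P₀ = P₀ * Z * P₀ := by
    have h1 : P₀ * (M * W + W * Mᵀ) * P₀ = P₀ * M + Mᵀ * P₀ := by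
      rw [mul_add, add_mul, ← mul_assoc P₀ W, hPW, one_mul, mul_assoc P₀ (M * W), mul_assoc M, hWP,
        mul_one]
    rw [hW, mul_neg, neg_mul] at h1
    rw [← neg_inj, h1, hM]
    simp only [mul_neg, mul_add, neg_mul, add_mul, Matrix.transpose_neg, Matrix.transpose_add,
      Matrix.transpose_smul, Matrix.transpose_one, mul_smul_comm, smul_mul_assoc, mul_one, one_mul]
    have : ε • P₀ = (ε / 2) • P₀ + (ε / 2) • P₀ := by rw [← add_smul, add_halves]
    rw [this]
    abel
  have hP : P₀ * Q = Qᵀ * P₀ * Q := by rw [← hPQ, mul_assoc, hQ]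
  have hPp : (P₀ * Q).PosSemidef := by
    rw [hP, ← Matrix.conjTranspose_eq_transpose_of_trivial]
    exact hP₀p.conjTranspose_mul_mul_same Q
  refine ⟨P₀ * Q, hPp, ?_, ?_, W.trace, hWp.trace_nonneg, fun x => ?_⟩
  · -- multiply the equation for `P₀` by `Q` from both sides
    have h0 : Qᵀ * P₀ * (1 - Q) = 0 := by rw [mul_sub, mul_one, ← hP, hPQ, sub_self]
    have h1 : Qᵀ * (P₀ * Z * P₀) * Q = P₀ * Q * B * Bᵀ * (P₀ * Q) := by
      calc _ = (Qᵀ * P₀ * Q) * B * Bᵀ * (Qᵀ * P₀ * Q)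
          + (Qᵀ * P₀ * (1 - Q)) * ((1 - Q)ᵀ * P₀ * Q) := by
            rw [hZ]; simp only [Matrix.transpose_mul, mul_add, add_mul, Matrix.mul_assoc]
        _ = _ := by rw [h0, zero_mul, add_zero, ← hP]
    rw [← h1, ← hARE]
    simp only [mul_add, add_mul, Matrix.transpose_mul, mul_smul_comm, smul_mul_assoc]
    have e1 : Qᵀ * (Qᵀ * Aᵀ * P₀) * Q = Aᵀ * (P₀ * Q) := by
      rw [hQAT]
      calc _ = (Qᵀ * Aᵀ) * Qᵀ * P₀ * Q := by simp only [mul_assoc]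
        _ = Aᵀ * (Qᵀ * Qᵀ) * P₀ * Q := by rw [hQAT]; simp only [mul_assoc]
        _ = _ := by rw [hQT, mul_assoc, mul_assoc, ← mul_assoc Qᵀ, ← hP]
    have e2 : Qᵀ * (P₀ * (A * Q)) * Q = P₀ * Q * A := by
      calc _ = Qᵀ * P₀ * (A * (Q * Q)) := by simp only [mul_assoc]
        _ = _ := by rw [hQ, hAQ, ← mul_assoc, ← hP]
    rw [e1, e2, ← hP]
  · have h1 : (P₀ * Z).trace = Fintype.card ι * ε := by
      have h2 := congrArg (fun Y => (Y * W).trace) hARE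
      simp only [add_mul, Matrix.trace_add, smul_mul_assoc, Matrix.trace_smul, hPW,
        mul_assoc, mul_one, Matrix.trace_one, Matrix.trace_transpose] at h2
      rw [Matrix.trace_mul_comm P₀, mul_assoc, mul_assoc, hWP, mul_one,
        trace_eq_zero_of_eigs_imaginary him] at h2
      rw [← h2, smul_eq_mul]; ring
    have h3 : (Bᵀ * (P₀ * Q) * B).trace = (P₀ * ((Q * B) * (Q * B)ᵀ)).trace := by
      rw [hP, ← Matrix.mul_assoc P₀, Matrix.trace_mul_comm _ (Q * B)ᵀ, Matrix.transpose_mul]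
      simp only [Matrix.mul_assoc]
    have h4 : 0 ≤ (P₀ * ((1 - Q) * (1 - Q)ᵀ)).trace := by
      rw [← mul_assoc, Matrix.trace_mul_comm]
      have h5 := (hP₀p.conjTranspose_mul_mul_same (1 - Q)).trace_nonneg
      rwa [Matrix.conjTranspose_eq_transpose_of_trivial, mul_assoc] at h5
    rw [h3, ← h1, hZ, mul_add, Matrix.trace_add]
    linarith
  · -- by Cauchy–Schwarz, `|y|² = y* P₀ (W y)` is at most the geometric mean of `y* P₀ y` and
    -- `y* W y`
    obtain ⟨y, hy⟩ : ∃ y, y = toC Q *ᵥ x := ⟨_, rfl⟩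
    rw [← hy]
    have h1 : qform (P₀ * Q) x = qform P₀ y := by rw [hP, hy, qform_mulVec]
    have h2 := norm_hform_sq_le hP₀p y (toC W *ᵥ y)
    rw [hform_mulVec_right, hPW, hform_self_eq_qform Matrix.transpose_one, qform_mulVec P₀ W,
      hWs, mul_assoc, hPW, mul_one, Complex.norm_real, Real.norm_eq_abs, sq_abs] at h2
    have h3 := qform_le_trace_mul hWp y
    have h4 := qform_nonneg hP₀p y
    rw [h1]
    rcases (qform_one_nonneg y).eq_or_lt with h5 | h5
    · rw [← h5]
      exact mul_nonneg hWp.trace_nonneg h4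
    · refine le_of_mul_le_mul_right ?_ h5
      nlinarith [mul_le_mul_of_nonneg_left h3 h4]

end Riccati

/-! ### Halanay's inequality -/

section Halanay

open Filter Set

/-- Halanay's inequality: if `y' ≤ -a y + b sup y` with the supremum over a window of length `r`
into the past and `b < a`, then `y` decays exponentially. The rate `γ` is chosen with
`γ + b exp(γ r) < a`; at the first time at which `y` meets `C exp(-γ (t - t₀))`, the derivative
of `y` would then be smaller than the derivative of this function. -/
lemma exists_halanay_rate {a b r : ℝ} (hba : b < a) (hr : 0 ≤ r) :
    ∃ γ : ℝ, 0 < γ ∧ ∀ (t₀ : ℝ) (y y' : ℝ → ℝ) (C : ℝ), 0 < C →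
      ContinuousOn y (Ici (t₀ - r)) → (∀ t, t₀ < t → HasDerivAt y (y' t) t) →
      (∀ t, t₀ < t → ∀ m, (∀ s ∈ Icc (t - r) t, y s ≤ m) → y' t ≤ -a * y t + b * m) →
      (∀ s ∈ Icc (t₀ - r) t₀, y s < C) →
      ∀ t, t₀ ≤ t → y t ≤ C * Real.exp (-γ * (t - t₀)) := by
  obtain ⟨γ, hγa, hγ⟩ : ∃ γ : ℝ, γ + b * Real.exp (γ * r) < a ∧ 0 < γ := by
    have hcont : Continuous fun γ : ℝ => γ + b * Real.exp (γ * r) := by fun_prop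
    have h1 : ∀ᶠ γ in 𝓝 (0 : ℝ), γ + b * Real.exp (γ * r) < a :=
      hcont.continuousAt.eventually_lt_const (by simpa using hba)
    exact ((h1.filter_mono nhdsWithin_le_nhds).and self_mem_nhdsWithin).exists (f := 𝓝[>] 0)
  refine ⟨γ, hγ, fun t₀ y y' C hC hy hder hineq hhist t₁ ht₁ => ?_⟩
  set z : ℝ → ℝ := fun t => C * Real.exp (-γ * (t - t₀)) with hz
  have hzder : ∀ t, HasDerivAt z (-γ * z t) t := by
    intro t
    have h1 : HasDerivAt (fun t : ℝ => -γ * (t - t₀)) (-γ) t := by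
      simpa using ((hasDerivAt_id t).sub_const t₀).const_mul (-γ)
    convert! (h1.exp.const_mul C) using 1
    rw [hz]; ring
  have hzcont : Continuous z := by rw [hz]; fun_prop
  have hzanti : ∀ s t, s ≤ t → z t ≤ z s := fun s t hst => by
    simp only [hz]
    gcongr C * Real.exp ?_
    nlinarith
  by_contra! hlt
  have hy' : ContinuousOn y (Icc t₀ t₁) := hy.mono fun s hs => by
    simp only [mem_Ici]; linarith [hs.1]
  have hclosed : IsCompact {t ∈ Icc t₀ t₁ | z t ≤ y t} :=
    isCompact_Icc.of_isClosed_subset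
      (isClosed_Icc.isClosed_le hzcont.continuousOn hy') (fun _ h => h.1)
  obtain ⟨T, ⟨hT, hTy⟩, hleast⟩ := hclosed.exists_isLeast ⟨t₁, ⟨ht₁, le_rfl⟩, hlt.le⟩
  have hT0 : t₀ < T := by
    refine lt_of_le_of_ne hT.1 fun h => ?_
    have h1 := hhist t₀ ⟨by linarith, le_rfl⟩
    rw [← h] at hTy
    simp only [hz, sub_self, mul_zero, Real.exp_zero, mul_one] at hTy
    linarith
  have hbefore : ∀ s, t₀ ≤ s → s < T → y s < z s := fun s hs hsT => by
    by_contra! h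
    exact absurd (hleast ⟨⟨hs, hsT.le.trans hT.2⟩, h⟩) (not_le.2 hsT)
  have hev : ∀ᶠ s in 𝓝[<] T, t₀ < s ∧ s < T :=
    (eventually_nhdsWithin_of_eventually_nhds (lt_mem_nhds hT0)).and self_mem_nhdsWithin
  have hle : y T ≤ z T := by
    refine le_of_tendsto_of_tendsto ((hder T hT0).continuousAt.tendsto.mono_left
      (nhdsWithin_le_nhds (s := Iio T)))
      (hzcont.continuousAt.tendsto.mono_left nhdsWithin_le_nhds) ?_
    filter_upwards [hev] with s hs using (hbefore s hs.1.le hs.2).le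
  have hyz : y T = z T := le_antisymm hle hTy
  have hm : ∀ s ∈ Icc (T - r) T, y s ≤ z (T - r) := by
    intro s hs
    have hzs : z s ≤ z (T - r) := hzanti _ _ hs.1
    rcases lt_or_ge s t₀ with h | h
    · have h1 := hhist s ⟨by linarith [hs.1], h.le⟩
      have h2 := hzanti s t₀ h.le
      simp only [hz, sub_self, mul_zero, Real.exp_zero, mul_one] at h2
      exact (h1.le.trans h2).trans hzs
    · rcases hs.2.lt_or_eq with h2 | rfl
      · exact (hbefore s h h2).le.trans hzs
      · exact hle.trans hzs
  have h1 := hineq T hT0 _ hm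
  have h2 : z (T - r) = Real.exp (γ * r) * z T := by
    simp only [hz]
    rw [mul_left_comm, ← Real.exp_add]
    ring_nf
  have hzpos : 0 < z T := by simp only [hz]; positivity
  have h3 : y' T - -γ * z T < 0 := by
    rw [h2, hyz] at h1
    nlinarith
  have h4 := (hasDerivAt_iff_tendsto_slope_left_right.1 ((hder T hT0).sub (hzder T))).1
  refine absurd (ge_of_tendsto h4 (b := 0) ?_) (not_le.2 h3)
  filter_upwards [hev] with s hs
  rw [slope_def_field]
  refine div_nonneg_of_nonpos ?_ (by linarith [hs.2])
  simp only [Pi.sub_apply]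
  linarith [hbefore s hs.1.le hs.2]

end Halanay

/-! ### Derivatives along trajectories -/

section Derivatives

open NormedSpace

variable [Fintype ι] [Fintype κ] {x : ℝ → ι → ℂ} {x' : ι → ℂ} {s : Set ℝ} {t : ℝ}

omit [Fintype κ] in
lemma hasDerivWithinAt_mulVec {F : ℝ → Matrix κ ι ℂ} {F' : Matrix κ ι ℂ}
    (hF : ∀ i j, HasDerivWithinAt (fun u => F u i j) (F' i j) s t)
    (hx : HasDerivWithinAt x x' s t) :
    HasDerivWithinAt (fun u => F u *ᵥ x u) (F' *ᵥ x t + F t *ᵥ x') s t := by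
  rw [hasDerivWithinAt_pi] at hx ⊢
  intro i
  convert! HasDerivWithinAt.fun_sum (u := Finset.univ) fun j _ => (hF i j).mul (hx j) using 1
  simp [Matrix.mulVec, dotProduct, Finset.sum_add_distrib]

omit [Fintype κ] in
lemma hasDerivWithinAt_const_mulVec (F : Matrix κ ι ℂ) (hx : HasDerivWithinAt x x' s t) :
    HasDerivWithinAt (fun u => F *ᵥ x u) (F *ᵥ x') s t := by
  simpa using hasDerivWithinAt_mulVec (F := fun _ => F) (F' := 0)
    (fun i j => hasDerivWithinAt_const t s (F i j)) hx

lemma hasDerivWithinAt_hform (P : Matrix κ ι ℝ) (u : κ → ℂ) (hx : HasDerivWithinAt x x' s t) :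
    HasDerivWithinAt (fun r => hform P u (x r)) (hform P u x') s t := by
  have h := hasDerivWithinAt_pi.1 (hasDerivWithinAt_const_mulVec (toC P) hx)
  exact HasDerivWithinAt.fun_sum (u := Finset.univ) fun i _ => (h i).const_mul (star u i)

lemma hasDerivWithinAt_qform {P : Matrix ι ι ℝ} (hP : Pᵀ = P) (hx : HasDerivWithinAt x x' s t) :
    HasDerivWithinAt (fun r => qform P (x r)) (2 * (hform P (x t) x').re) s t := by
  have h1 := hasDerivWithinAt_pi.1 (hasDerivWithinAt_const_mulVec (toC P) hx)
  have h2 := hasDerivWithinAt_pi.1 hx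
  have h3 : HasDerivWithinAt (fun r => hform P (x r) (x r))
      (hform P x' (x t) + hform P (x t) x') s t := by
    convert! HasDerivWithinAt.fun_sum (u := Finset.univ) fun i _ => (h2 i).star.mul (h1 i) using 1
    simp [hform, dotProduct, Finset.sum_add_distrib]
  have h4 := Complex.reCLM.hasFDerivAt.comp_hasDerivWithinAt t h3
  convert! h4 using 1
  have h5 := star_hform P x' (x t)
  rw [hP] at h5
  simp only [Complex.reCLM_apply, Complex.add_re]
  rw [← h5, two_mul, Complex.star_def, Complex.conj_re]

variable [DecidableEq ι]

/-- The derivative of `r ↦ exp((b - r) M) x(r)`. -/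
lemma hasDerivWithinAt_exp_sub_mulVec (M : Matrix ι ι ℝ) (b : ℝ)
    (hx : HasDerivWithinAt x x' s t) :
    HasDerivWithinAt (fun r => toC (exp ((b - r) • M)) *ᵥ x r)
      (toC (exp ((b - t) • M)) *ᵥ (x' - toC M *ᵥ x t)) s t := by
  have h := hasDerivWithinAt_mulVec (F := fun r => toC (exp ((b - r) • M)))
    (F' := toC (-(exp ((b - t) • M) * M))) (s := s) (t := t) ?_ hx
  · convert! h using 1
    rw [toC_neg, toC_mul, Matrix.neg_mulVec, ← Matrix.mulVec_mulVec, Matrix.mulVec_sub]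
    abel
  · intro i j
    have h1 := (hasDerivAt_exp_smul_apply M (b - t) i j).comp_const_sub b t
    have h2 : M * exp ((b - t) • M) = exp ((b - t) • M) * M :=
      ((Commute.refl M).smul_right (b - t)).exp_right.eq
    rw [h2] at h1
    have h3 := Complex.ofRealCLM.hasFDerivAt.comp_hasDerivAt t h1
    convert! h3.hasDerivWithinAt using 1

end Derivatives

/-! ### Bounds in terms of the initial function -/

section History

variable [Fintype ι] [Fintype κ]

lemma exists_norm_mulVec_le (M : Matrix κ ι ℂ) :
    ∃ c : ℝ, 0 ≤ c ∧ ∀ v : ι → ℂ, ‖M *ᵥ v‖ ≤ c * ‖v‖ :=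
  ⟨_, norm_nonneg _, (LinearMap.toContinuousLinearMap M.mulVecLin).le_opNorm⟩

/-- Up to time `τ` the delayed input is determined by the initial function, and Gronwall's
inequality bounds the state in terms of it. -/
lemma exists_history_bound (M : Matrix ι ι ℝ) (L : Matrix ι κ ℝ) (l : ℂ) {τ : ℝ} (hτ : 0 ≤ τ)
    (K : Matrix κ ι ℝ) :
    ∃ G : ℝ, 0 < G ∧ ∀ (x : ℝ → ι → ℂ), IsClosedLoop M L l τ K x → ∀ h : ℝ,
      (∀ θ ∈ Set.Icc (-τ) 0, ‖x θ‖ ≤ h) → ∀ t ∈ Set.Icc (-τ) τ, ‖x t‖ ≤ G * h := by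
  obtain ⟨a, ha, hMa⟩ := exists_norm_mulVec_le (toC M)
  obtain ⟨b, hb, hLb⟩ := exists_norm_mulVec_le (l • toC L * toC K)
  refine ⟨gronwallBound 1 (a + 1) b τ, ?_, fun x hx h hh t ht => ?_⟩
  · rw [gronwallBound_of_K_ne_0 (by positivity)]
    have : 1 ≤ Real.exp ((a + 1) * τ) := Real.one_le_exp (by positivity)
    have h2 : 0 ≤ b / (a + 1) * (Real.exp ((a + 1) * τ) - 1) :=
      mul_nonneg (by positivity) (by linarith)
    linarith
  have hh0 : 0 ≤ h := (norm_nonneg _).trans (hh 0 ⟨by linarith, le_rfl⟩)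
  have hscale : ∀ r, gronwallBound h (a + 1) (b * h) r = gronwallBound 1 (a + 1) b r * h :=
    fun r => by
      rw [gronwallBound_of_K_ne_0 (by positivity), gronwallBound_of_K_ne_0 (by positivity)]; ring
  have hone : 1 ≤ gronwallBound 1 (a + 1) b τ := by
    have := gronwallBound_mono zero_le_one hb (by positivity : 0 ≤ a + 1) hτ
    rwa [gronwallBound_x0] at this
  rcases le_total t 0 with ht0 | ht0
  · calc ‖x t‖ ≤ 1 * h := by rw [one_mul]; exact hh t ⟨ht.1, ht0⟩
      _ ≤ _ := by gcongr
  have hg := norm_le_gronwallBound_of_norm_deriv_right_le (f := x)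
    (f' := fun t => toC M *ᵥ x t + l • toC L *ᵥ (toC K *ᵥ x (t - τ)))
    (δ := h) (K := a + 1) (ε := b * h) (a := 0) (b := τ)
    (hx.1.mono fun s hs => by simp only [Set.mem_Ici]; linarith [hs.1])
    (fun s hs => (hx.2 s hs.1).mono (Set.Ici_subset_Ici.2 hs.1))
    (hh 0 ⟨by linarith, le_rfl⟩)
    (fun s hs => by
      have h1 := hh (s - τ) ⟨by linarith [hs.1], by linarith [hs.2]⟩
      have h2 : l • toC L *ᵥ (toC K *ᵥ x (s - τ)) = (l • toC L * toC K) *ᵥ x (s - τ) := by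
        rw [← Matrix.mulVec_mulVec, Matrix.smul_mulVec]
      rw [h2]
      refine (norm_add_le _ _).trans (add_le_add ?_ ?_)
      · refine (hMa _).trans ?_
        gcongr
        linarith
      · exact (hLb _).trans (by gcongr))
    t ⟨ht0, ht.2⟩
  rw [hscale, sub_zero] at hg
  refine hg.trans ?_
  gcongr
  exact gronwallBound_mono zero_le_one hb (by positivity : 0 ≤ a + 1) ht.2

end History

/-! ### Low gain truncated predictor feedback -/

section LowGain

open NormedSpace Set

variable [Fintype ι] [DecidableEq ι] [Fintype κ] [DecidableEq κ]

/-- `P` is a positive semidefinite solution of the parametric Riccati equation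
`Aᵀ P + P A - P B Bᵀ P = -ε P` with `tr (Bᵀ P B) ≤ η`. -/
structure IsRiccatiSolution (A : Matrix ι ι ℝ) (B : Matrix ι κ ℝ) (P : Matrix ι ι ℝ) (ε η : ℝ) :
    Prop where
  posSemidef : P.PosSemidef
  eps_nonneg : 0 ≤ ε
  riccati : Aᵀ * P + P * A + ε • P = P * B * Bᵀ * P
  trace_le : (Bᵀ * P * B).trace ≤ η

/-- The truncated predictor feedback `u = -c Bᵀ P exp(A τ) x`: the feedback `-c Bᵀ P` applied to
the state that the uncontrolled system would have after the time `τ`. -/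
noncomputable def predictorGain (A : Matrix ι ι ℝ) (B : Matrix ι κ ℝ) (P : Matrix ι ι ℝ)
    (c τ : ℝ) : Matrix κ ι ℝ :=
  (-c) • (Bᵀ * P * exp (τ • A))

lemma two_mul_le_add_of_sq_le {h a b : ℝ} (ha : 0 ≤ a) (hb : 0 ≤ b) (hab : h ^ 2 ≤ a * b) :
    2 * h ≤ a + b := by
  by_contra! hlt
  nlinarith [sq_nonneg (a - b)]

omit [DecidableEq ι] [DecidableEq κ] in
lemma qform_add_transpose (P : Matrix ι ι ℝ) (x : ι → ℂ) :
    qform (P + Pᵀ) x = 2 * (hform P x x).re := by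
  rw [qform_add_matrix, two_mul, qform, qform, ← star_hform, Complex.star_def, Complex.conj_re]

namespace IsRiccatiSolution

variable {A : Matrix ι ι ℝ} {B : Matrix ι κ ℝ} {P : Matrix ι ι ℝ} {ε η : ℝ}

section
variable (h : IsRiccatiSolution A B P ε η)
include h

omit [DecidableEq ι] [DecidableEq κ] in
lemma isSymm : Pᵀ = P := transpose_eq_of_posSemidef h.posSemidef

omit [DecidableEq ι] [DecidableEq κ] in
lemma posSemidef_input : (Bᵀ * P * B).PosSemidef := by
  rw [← Matrix.conjTranspose_eq_transpose_of_trivial]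
  exact h.posSemidef.conjTranspose_mul_mul_same B

omit [DecidableEq ι] [DecidableEq κ] in
lemma eta_nonneg : 0 ≤ η := h.posSemidef_input.trace_nonneg.trans h.trace_le

omit [DecidableEq ι] in
lemma qform_input_le (w : κ → ℂ) : qform P (toC B *ᵥ w) ≤ η * qform 1 w := by
  rw [qform_mulVec]
  exact (qform_le_trace_mul h.posSemidef_input w).trans
    (mul_le_mul_of_nonneg_right h.trace_le (qform_one_nonneg w))

omit [DecidableEq ι] in
lemma qform_gain (x : ι → ℂ) :
    qform 1 (toC (Bᵀ * P) *ᵥ x) = qform (P * B * Bᵀ * P) x := by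
  rw [qform_mulVec, Matrix.mul_one, Matrix.transpose_mul, Matrix.transpose_transpose, h.isSymm]
  simp only [Matrix.mul_assoc]

omit [DecidableEq ι] [DecidableEq κ] in
lemma posSemidef_gain : (P * B * Bᵀ * P).PosSemidef := by
  have := posSemidef_mul_transpose (P * B)
  rwa [Matrix.transpose_mul, h.isSymm, ← Matrix.mul_assoc] at this

/-- The bound `P B Bᵀ P ≤ η P`. It follows from `Bᵀ P B ≤ η` by the Cauchy–Schwarz inequality for
`x* P B Bᵀ P x`, viewed as the product of `x` and `B Bᵀ P x` in the form of `P`. -/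
lemma qform_gain_le (x : ι → ℂ) : qform (P * B * Bᵀ * P) x ≤ η * qform P x := by
  have h1 := norm_hform_sq_le h.posSemidef x (toC B *ᵥ (toC (Bᵀ * P) *ᵥ x))
  have h2 := h.qform_input_le (toC (Bᵀ * P) *ᵥ x)
  rw [h.qform_gain] at h2
  rw [hform_mulVec_right, hform_mulVec_right, ← Matrix.mul_assoc,
    hform_self_eq_qform (transpose_eq_of_posSemidef h.posSemidef_gain), Complex.norm_real,
    Real.norm_eq_abs, sq_abs] at h1
  have h3 := qform_nonneg h.posSemidef x
  rcases (qform_nonneg h.posSemidef_gain x).eq_or_lt with h4 | h4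
  · rw [← h4]; exact mul_nonneg h.eta_nonneg h3
  · refine le_of_mul_le_mul_right ?_ h4
    nlinarith [mul_le_mul_of_nonneg_left h2 h3]

omit [DecidableEq ι] [DecidableEq κ] in
lemma two_mul_re_hform_drift (x : ι → ℂ) :
    2 * (hform P x (toC A *ᵥ x)).re = qform (P * B * Bᵀ * P) x - ε * qform P x := by
  rw [hform_mulVec_right, ← qform_add_transpose, Matrix.transpose_mul, h.isSymm, add_comm,
    ← h.riccati]
  simp only [qform_add_matrix, qform_smul_matrix]
  ring

/-- The form of `P` grows at most at the rate `η` along the uncontrolled system. -/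
lemma qform_exp_le {t : ℝ} (ht : 0 ≤ t) (v : ι → ℂ) :
    qform P (toC (exp (t • A)) *ᵥ v) ≤ Real.exp (η * t) * qform P v := by
  have hder : ∀ r : ℝ, HasDerivAt (fun r : ℝ => toC (exp (r • A)) *ᵥ v)
      (toC A *ᵥ (toC (exp (r • A)) *ᵥ v)) r := by
    intro r
    have h1 := hasDerivWithinAt_mulVec (F := fun r : ℝ => toC (exp (r • A)))
      (F' := toC (A * exp (r • A))) (s := univ) (t := r) (x := fun _ => v) (x' := 0)
      (fun i j => by
        have h3 := Complex.ofRealCLM.hasFDerivAt.comp_hasDerivAt r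
          (hasDerivAt_exp_smul_apply A r i j)
        exact h3.hasDerivWithinAt) (hasDerivWithinAt_const _ _ _)
    rw [hasDerivWithinAt_univ] at h1
    simpa [toC_mul, Matrix.mulVec_mulVec] using h1
  have hder2 : ∀ r : ℝ, HasDerivAt
      (fun r : ℝ => Real.exp (-η * r) * qform P (toC (exp (r • A)) *ᵥ v))
      (Real.exp (-η * r) * -η * qform P (toC (exp (r • A)) *ᵥ v) + Real.exp (-η * r) *
        (2 * (hform P (toC (exp (r • A)) *ᵥ v)
          (toC A *ᵥ (toC (exp (r • A)) *ᵥ v))).re)) r := by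
    intro r
    have h1 := hasDerivWithinAt_qform h.isSymm (hder r).hasDerivWithinAt (s := univ)
    rw [hasDerivWithinAt_univ] at h1
    have h2 : HasDerivAt (fun r : ℝ => -η * r) (-η) r := by
      simpa using (hasDerivAt_id r).const_mul (-η)
    exact h2.exp.mul h1
  have hanti := antitone_of_hasDerivAt_nonpos hder2 fun r => by
    set y := toC (exp (r • A)) *ᵥ v
    rw [h.two_mul_re_hform_drift]
    have h1 := h.qform_gain_le y
    have h2 := mul_nonneg h.eps_nonneg (qform_nonneg h.posSemidef y)
    have h3 := Real.exp_pos (-η * r)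
    simp only [Pi.zero_apply]
    nlinarith [mul_le_mul_of_nonneg_left h1 h3.le, mul_nonneg h3.le h2]
  have h1 := hanti ht
  simp only [exp_zero_smul, toC_one, Matrix.one_mulVec, mul_zero, Real.exp_zero, one_mul] at h1
  calc _ = Real.exp (η * t) *
        (Real.exp (-η * t) * qform P (toC (exp (t • A)) *ᵥ v)) := by
        rw [← mul_assoc, ← Real.exp_add]; simp
    _ ≤ _ := by gcongr

lemma qform_predictorGain_le {τ : ℝ} (hτ : 0 ≤ τ) (c : ℝ) (v : ι → ℂ) :
    qform 1 (toC (predictorGain A B P c τ) *ᵥ v) ≤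
      c ^ 2 * (η * (Real.exp (η * τ) * qform P v)) := by
  have h1 : toC (predictorGain A B P c τ) *ᵥ v =
      ((-c : ℝ) : ℂ) • (toC (Bᵀ * P) *ᵥ (toC (exp (τ • A)) *ᵥ v)) := by
    rw [predictorGain, toC_smul, Matrix.smul_mulVec, toC_mul (Bᵀ * P), ← Matrix.mulVec_mulVec]
  rw [h1, qform_smul, h.qform_gain, Complex.norm_real, Real.norm_eq_abs, sq_abs, neg_sq]
  have h2 := h.qform_gain_le (toC (exp (τ • A)) *ᵥ v)
  have h3 := h.qform_exp_le hτ v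
  have := h.eta_nonneg
  gcongr
  exact h2.trans (by gcongr)

end

variable {l : ℂ} {τ c : ℝ} {x : ℝ → ι → ℂ} {t m : ℝ}

/-- The prediction `exp(A τ) x(t - τ)` of `x(t)` has an error of the order of the gain. This is the
variation of constants formula, in the form of a mean value inequality for
`s ↦ exp(A (t - s)) x(s)`. -/
lemma norm_hform_prediction_error_sq_le (h : IsRiccatiSolution A B P ε η) (hτ : 0 ≤ τ)
    (hx : IsClosedLoop A B l τ (predictorGain A B P c τ) x) (ht : τ ≤ t)
    (hm : ∀ s ∈ Icc (t - 2 * τ) t, qform P (x s) ≤ m) (u : ι → ℂ) :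
    ‖hform (P * B * Bᵀ * P) u (x t - toC (exp (τ • A)) *ᵥ x (t - τ))‖ ^ 2 ≤
      qform (P * B * Bᵀ * P) u *
        (τ ^ 2 * c ^ 2 * ‖l‖ ^ 2 * η ^ 3 * Real.exp (2 * η * τ) * m) := by
  have hη := h.eta_nonneg
  have hm0 : 0 ≤ m := (qform_nonneg h.posSemidef (x t)).trans (hm t ⟨by linarith, le_rfl⟩)
  set Γ := P * B * Bᵀ * P with hΓ
  have hΓp : Γ.PosSemidef := h.posSemidef_gain
  set k : ℝ := c ^ 2 * ‖l‖ ^ 2 * η ^ 3 * Real.exp (2 * η * τ) * m with hk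
  set D : ℝ := √(qform Γ u * k) with hD
  have hk0 : 0 ≤ k := by positivity
  have hu0 := qform_nonneg hΓp u
  set f : ℝ → ℂ := fun s => hform Γ u (toC (exp ((t - s) • A)) *ᵥ x s) with hf
  set w : ℝ → ι → ℂ := fun s =>
    toC B *ᵥ (toC (predictorGain A B P c τ) *ᵥ x (s - τ)) with hw
  have hder : ∀ s ∈ Icc (t - τ) t, HasDerivWithinAt f
      (hform Γ u (toC (exp ((t - s) • A)) *ᵥ (l • w s))) (Icc (t - τ) t) s := by
    intro s hs
    have h1 := (hx.2 s (by linarith [hs.1])).mono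
      (fun r hr => by simp only [mem_Ici]; linarith [hr.1] : Icc (t - τ) t ⊆ Ici 0)
    have h2 := hasDerivWithinAt_hform Γ u (hasDerivWithinAt_exp_sub_mulVec A t h1)
    simpa only [add_sub_cancel_left] using h2
  have hbound : ∀ s ∈ Ico (t - τ) t,
      ‖hform Γ u (toC (exp ((t - s) • A)) *ᵥ (l • w s))‖ ≤ D := by
    intro s hs
    refine Real.le_sqrt_of_sq_le ((norm_hform_sq_le hΓp u _).trans ?_)
    gcongr
    have hts : 0 ≤ t - s := by linarith [hs.2]
    have e1 : qform 1 (toC (predictorGain A B P c τ) *ᵥ x (s - τ)) ≤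
        c ^ 2 * (η * (Real.exp (η * τ) * m)) := by
      refine (h.qform_predictorGain_le hτ c _).trans ?_
      gcongr
      exact hm _ ⟨by linarith [hs.1], by linarith [hs.2]⟩
    have e2 : qform P (w s) ≤ η * (c ^ 2 * (η * (Real.exp (η * τ) * m))) :=
      (h.qform_input_le _).trans (by gcongr)
    calc qform Γ (toC (exp ((t - s) • A)) *ᵥ (l • w s))
        ≤ η * qform P (toC (exp ((t - s) • A)) *ᵥ (l • w s)) := h.qform_gain_le _
      _ ≤ η * (Real.exp (η * (t - s)) * qform P (l • w s)) := by
          gcongr; exact h.qform_exp_le hts _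
      _ ≤ η * (Real.exp (η * τ) *
            (‖l‖ ^ 2 * (η * (c ^ 2 * (η * (Real.exp (η * τ) * m)))))) := by
          rw [qform_smul]
          have := qform_nonneg h.posSemidef (w s)
          gcongr
          linarith [hs.1]
      _ = k := by
          rw [hk, mul_assoc 2, two_mul, Real.exp_add]; ring
  have hmv := norm_image_sub_le_of_norm_deriv_le_segment' hder hbound t
    ⟨by linarith, le_rfl⟩
  have hf1 : f t - f (t - τ) = hform Γ u (x t - toC (exp (τ • A)) *ᵥ x (t - τ)) := by
    simp only [hf, sub_self, sub_sub_cancel, exp_zero_smul, toC_one, Matrix.one_mulVec,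
      hform_sub_right]
  rw [hf1, sub_sub_cancel] at hmv
  calc _ ≤ (D * τ) ^ 2 := by gcongr
    _ = _ := by
      rw [mul_pow, hD, Real.sq_sqrt (by positivity), hk]; ring

/-- Along the closed loop, the derivative of `x* P x` is at most `-ε x* P x` up to an error of
order `η³`. The instantaneous feedback `-c Bᵀ P` contributes `-2 c (Re l) x* P B Bᵀ P x`,
which dominates the indefinite terms as soon as `c Re l ≥ 1`. -/
lemma two_mul_re_hform_closedLoop_le (h : IsRiccatiSolution A B P ε η) (hτ : 0 ≤ τ)
    (hx : IsClosedLoop A B l τ (predictorGain A B P c τ) x) (hc : 0 ≤ c) (hcl : 1 ≤ c * l.re)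
    (ht : τ ≤ t) (hm : ∀ s ∈ Icc (t - 2 * τ) t, qform P (x s) ≤ m) :
    2 * (hform P (x t) (toC A *ᵥ x t +
        l • toC B *ᵥ (toC (predictorGain A B P c τ) *ᵥ x (t - τ)))).re ≤
      -ε * qform P (x t) +
        (c * ‖l‖) ^ 4 * τ ^ 2 * Real.exp (2 * η * τ) * η ^ 3 * m := by
  have hη := h.eta_nonneg
  have hm0 : 0 ≤ m := (qform_nonneg h.posSemidef (x t)).trans (hm t ⟨by linarith, le_rfl⟩)
  have herr := h.norm_hform_prediction_error_sq_le hτ hx ht hm (x t)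
  set Γ := P * B * Bᵀ * P with hΓ
  have hΓp : Γ.PosSemidef := h.posSemidef_gain
  set e := hform Γ (x t) (x t - toC (exp (τ • A)) *ᵥ x (t - τ)) with he
  have hfeed : hform P (x t) (l • toC B *ᵥ (toC (predictorGain A B P c τ) *ᵥ x (t - τ))) =
      l * (-c * (qform Γ (x t) - e)) := by
    rw [hform_smul_right, hform_mulVec_right, hform_mulVec_right, predictorGain,
      Matrix.mul_smul, hform_smul_matrix, he, hform_sub_right,
      hform_self_eq_qform (transpose_eq_of_posSemidef hΓp), sub_sub_cancel, hform_mulVec_right, hΓ]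
    simp only [Matrix.mul_assoc, Complex.ofReal_neg]
  have hre : (l * (-c * (qform Γ (x t) - e))).re =
      -(c * l.re) * qform Γ (x t) + c * (l * e).re := by
    simp; ring
  rw [hform_add_right, Complex.add_re, mul_add, h.two_mul_re_hform_drift, hfeed, hre]
  have h1 : (l * e).re ≤ ‖l‖ * ‖e‖ := (Complex.re_le_norm _).trans (norm_mul_le _ _)
  have h2 : 2 * (c * ‖l‖ * ‖e‖) ≤ qform Γ (x t) +
      (c * ‖l‖) ^ 4 * τ ^ 2 * Real.exp (2 * η * τ) * η ^ 3 * m := by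
    refine two_mul_le_add_of_sq_le (qform_nonneg hΓp _) (by positivity) ?_
    calc (c * ‖l‖ * ‖e‖) ^ 2 = (c * ‖l‖) ^ 2 * ‖e‖ ^ 2 := by ring
      _ ≤ (c * ‖l‖) ^ 2 * (qform Γ (x t) *
          (τ ^ 2 * c ^ 2 * ‖l‖ ^ 2 * η ^ 3 * Real.exp (2 * η * τ) * m)) := by gcongr
      _ = _ := by ring
  have h3 := qform_nonneg hΓp (x t)
  nlinarith [mul_le_mul_of_nonneg_right hcl h3, mul_le_mul_of_nonneg_left h1 hc]

end IsRiccatiSolution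

end LowGain

/-! ### Simultaneous stabilization -/

section Stabilization

open NormedSpace Set Filter Polynomial

variable [Fintype ι] [Fintype κ]

/-- An exponential estimate of all closed loop solutions by their initial functions implies
asymptotic stability. -/
lemma asymptoticallyStabilizes_of_exponential_bound {M : Matrix ι ι ℝ} {L : Matrix ι κ ℝ} {l : ℂ}
    {τ : ℝ} {K : Matrix κ ι ℝ} {G H γ : ℝ} (hG : 0 < G) (hH : 0 < H) (hγ : 0 < γ)
    (hbound : ∀ x : ℝ → ι → ℂ, IsClosedLoop M L l τ K x → ∀ h : ℝ, 0 < h →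
      (∀ θ ∈ Icc (-τ) 0, ‖x θ‖ ≤ h) →
      (∀ t ∈ Icc (-τ) τ, ‖x t‖ ≤ G * h) ∧
      ∀ t, τ ≤ t → ‖x t‖ ^ 2 ≤ H * h ^ 2 * Real.exp (-γ * (t - τ))) :
    AsymptoticallyStabilizes M L l τ K := by
  refine ⟨fun ε hε => ?_, fun x hx => ?_⟩
  · refine ⟨ε / (G + √H), by positivity, fun x hx hhist t ht => ?_⟩
    obtain ⟨h1, h2⟩ := hbound x hx (ε / (G + √H)) (by positivity) hhist
    have hle : ∀ a : ℝ, a ≤ G + √H → a * (ε / (G + √H)) ≤ ε := fun a ha => by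
      rw [mul_div_left_comm]
      exact mul_le_of_le_one_right hε.le ((div_le_one (by positivity)).2 ha)
    rcases le_total t τ with htτ | htτ
    · exact (h1 t ⟨by linarith, htτ⟩).trans (hle G (by linarith [Real.sqrt_nonneg H]))
    · refine le_trans ?_ (hle (√H) (by linarith))
      refine le_of_sq_le_sq ?_ (by positivity)
      rw [mul_pow, Real.sq_sqrt hH.le]
      refine (h2 t htτ).trans (mul_le_of_le_one_right (by positivity) ?_)
      rw [Real.exp_le_one_iff]
      nlinarith
  · obtain ⟨h, hh⟩ := (isCompact_Icc (a := -τ) (b := (0 : ℝ))).exists_bound_of_continuousOn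
      (hx.1.mono fun s hs => hs.1)
    obtain ⟨-, h2⟩ := hbound x hx (max h 1) (by positivity)
      fun θ hθ => (hh θ hθ).trans (le_max_left _ _)
    have h3 : Tendsto (fun t : ℝ => H * (max h 1) ^ 2 * Real.exp (-γ * (t - τ))) atTop (𝓝 0) := by
      rw [← mul_zero (H * (max h 1) ^ 2)]
      refine (Real.tendsto_exp_atBot.comp ?_).const_mul _
      exact (tendsto_atTop_add_const_right _ (-τ) tendsto_id).const_mul_atTop_of_neg (by linarith)
    have h4 : Tendsto (fun t => ‖x t‖ ^ 2) atTop (𝓝 0) :=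
      squeeze_zero' (.of_forall fun t => by positivity)
        ((eventually_ge_atTop τ).mono fun t ht => h2 t ht) h3
    rw [tendsto_zero_iff_norm_tendsto_zero]
    simpa using h4.sqrt

variable [DecidableEq ι]

lemma norm_sq_le_qform_one (x : ι → ℂ) : ‖x‖ ^ 2 ≤ qform 1 x := by
  refine (Real.le_sqrt (norm_nonneg _) (qform_one_nonneg x)).1 ?_
  refine (pi_norm_le_iff_of_nonneg (Real.sqrt_nonneg _)).2 fun i => ?_
  refine Real.le_sqrt_of_sq_le ?_
  rw [qform_one]
  exact Finset.single_le_sum (f := fun i => ‖x i‖ ^ 2) (fun _ _ => by positivity)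
    (Finset.mem_univ i)

lemma qform_one_le_norm_sq (x : ι → ℂ) : qform 1 x ≤ Fintype.card ι * ‖x‖ ^ 2 := by
  rw [qform_one, ← nsmul_eq_mul, ← Finset.card_univ]
  refine Finset.sum_le_card_nsmul _ _ _ fun i _ => ?_
  gcongr
  exact norm_le_pi_norm x i

lemma qform_one_add_le (x y : ι → ℂ) : qform 1 (x + y) ≤ 2 * qform 1 x + 2 * qform 1 y := by
  simp only [qform_one, Finset.mul_sum, ← Finset.sum_add_distrib]
  refine Finset.sum_le_sum fun i _ => ?_
  have h1 : ‖(x + y) i‖ ^ 2 ≤ (‖x i‖ + ‖y i‖) ^ 2 := by gcongr; exact norm_add_le _ _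
  nlinarith [sq_nonneg (‖x i‖ - ‖y i‖)]

omit [DecidableEq ι] in
lemma posSemidef_transpose_mul (T : Matrix ι κ ℝ) : (Tᵀ * T).PosSemidef := by
  have := posSemidef_mul_transpose Tᵀ
  rwa [Matrix.transpose_transpose] at this

lemma qform_one_mulVec_le [DecidableEq κ] (T : Matrix ι κ ℝ) (x : κ → ℂ) :
    qform 1 (toC T *ᵥ x) ≤ (Tᵀ * T).trace * qform 1 x := by
  rw [← qform_transpose_mul_self]
  exact qform_le_trace_mul (posSemidef_transpose_mul T) x

/-- A solution of a Lyapunov equation with right hand side `-1` is bounded below. -/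
lemma exists_qform_one_le {F R : Matrix ι ι ℝ} (hR : R.PosSemidef) (hFR : Fᵀ * R + R * F = -1) :
    ∃ k : ℝ, 0 < k ∧ ∀ x : ι → ℂ, qform 1 x ≤ k * qform R x := by
  have hFRF : (Fᵀ * R * F).PosSemidef := by
    rw [← Matrix.conjTranspose_eq_transpose_of_trivial]
    exact hR.conjTranspose_mul_mul_same F
  refine ⟨4 * (Fᵀ * R * F).trace + 1, by have := hFRF.trace_nonneg; positivity, fun x => ?_⟩
  have h1 : qform 1 x = -(2 * (hform R x (toC F *ᵥ x)).re) := by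
    rw [hform_mulVec_right, ← qform_add_transpose, Matrix.transpose_mul,
      transpose_eq_of_posSemidef hR, add_comm, hFR, qform_neg_matrix, neg_neg]
  have h2 := norm_hform_sq_le hR x (toC F *ᵥ x)
  rw [qform_mulVec] at h2
  have h3 := qform_le_trace_mul hFRF x
  have h4 := qform_nonneg hR x
  have h5 : qform 1 x ≤ 2 * ‖hform R x (toC F *ᵥ x)‖ := by
    have := (abs_le.1 (Complex.abs_re_le_norm (hform R x (toC F *ᵥ x)))).1
    linarith
  rcases (qform_one_nonneg x).eq_or_lt with h6 | h6
  · rw [← h6]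
    have := hFRF.trace_nonneg
    positivity
  · refine le_of_mul_le_mul_right ?_ h6
    have h7 : qform 1 x * qform 1 x ≤ 4 * ‖hform R x (toC F *ᵥ x)‖ ^ 2 := by
      nlinarith [norm_nonneg (hform R x (toC F *ᵥ x))]
    nlinarith [mul_le_mul_of_nonneg_left h3 h4, mul_nonneg h4 h6.le]

/-- The derivative of `x* R x` along `x' = A x + v`, where `A - Q` is Hurwitz with Lyapunov
matrix `R`. -/
lemma two_mul_re_hform_lyapunov_le {A Q R : Matrix ι ι ℝ} (hR : R.PosSemidef)
    (hAR : (A - Q)ᵀ * R + R * (A - Q) = -1) (x v : ι → ℂ) :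
    2 * (hform R x (toC A *ᵥ x + v)).re ≤ -(1 / 2) * qform 1 x +
      4 * (Rᵀ * R).trace * (qform 1 (toC Q *ᵥ x) + qform 1 v) := by
  have h1 : toC A *ᵥ x + v = toC (A - Q) *ᵥ x + (toC Q *ᵥ x + v) := by
    rw [toC_sub, Matrix.sub_mulVec]; abel
  rw [h1, hform_add_right, Complex.add_re, mul_add]
  have h2 : 2 * (hform R x (toC (A - Q) *ᵥ x)).re = -qform 1 x := by
    rw [hform_mulVec_right, ← qform_add_transpose, Matrix.transpose_mul,
      transpose_eq_of_posSemidef hR, add_comm, hAR, qform_neg_matrix]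
  set z := toC Q *ᵥ x + v with hz
  have h3 : ‖hform R x z‖ ^ 2 ≤ qform 1 x / 2 * (2 * qform 1 (toC R *ᵥ z)) := by
    have := norm_hform_sq_le Matrix.PosSemidef.one x (toC R *ᵥ z)
    rw [hform_mulVec_right, Matrix.one_mul] at this
    linarith
  have h4 := two_mul_le_add_of_sq_le (by linarith [qform_one_nonneg x])
    (by linarith [qform_one_nonneg (toC R *ᵥ z)]) h3
  have h5 := qform_one_mulVec_le R z
  have h6 := qform_one_add_le (toC Q *ᵥ x) v
  have h7 := (posSemidef_transpose_mul R).trace_nonneg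
  have h8 := Complex.re_le_norm (hform R x z)
  have h9 := mul_le_mul_of_nonneg_left h6 h7
  rw [h2]
  linarith

lemma exists_eigenvalue_of_aeval (A : Matrix ι ι ℝ) (f : ℝ[X]) {z : ℂ} (hz : z ∈ eigs (aeval A f)) :
    ∃ μ ∈ eigs A, z = aeval μ f := by
  obtain ⟨v, hv0, -⟩ := (mem_eigs_iff _ _).1 hz
  have : Nonempty ι := by
    by_contra h
    rw [not_nonempty_iff] at h
    exact hv0 (Subsingleton.elim _ _)
  rw [eigs, toC_aeval, spectrum.map_polynomial_aeval_of_nonempty _ _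
    (spectrum.nonempty_of_isAlgClosed_of_finiteDimensional ℂ _)] at hz
  obtain ⟨μ, hμ, h⟩ := hz
  exact ⟨μ, hμ, by rw [← h]; exact Polynomial.eval_map_algebraMap _ _⟩

/-- The data for low gain feedback: a matrix `Q` such that `A - Q` is Hurwitz with Lyapunov matrix
`R`, and for each small gain `ε` a Riccati solution controlling `Q x`. For `Q`, the spectral
projection of `A` onto the modes on the imaginary axis is taken. -/
lemma exists_lowGain_data {A : Matrix ι ι ℝ} {B : Matrix ι κ ℝ} (hA : ∀ μ ∈ eigs A, ¬ 0 < μ.re)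
    (hctrl : ∀ (μ : ℂ) (v : ι → ℂ), μ.re = 0 → toC Aᵀ *ᵥ v = μ • v → toC Bᵀ *ᵥ v = 0 → v = 0) :
    ∃ Q R : Matrix ι ι ℝ, R.PosSemidef ∧ (A - Q)ᵀ * R + R * (A - Q) = -1 ∧
      ∀ ε : ℝ, 0 < ε → ∃ P : Matrix ι ι ℝ,
        IsRiccatiSolution A B P ε (Fintype.card ι * ε) ∧
        ∃ c : ℝ, 0 ≤ c ∧ ∀ x : ι → ℂ, qform 1 (toC Q *ᵥ x) ≤ c * qform P x := by
  obtain ⟨q, hqq, hq1, hq0⟩ := exists_imaginary_axis_projection A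
  set Q := aeval A q with hQ
  have hAX : aeval A (X : ℝ[X]) = A := aeval_X A
  have hcomm : A * Q = Q * A := by
    rw [hQ]
    nth_rw 1 4 [← hAX]
    rw [← map_mul, ← map_mul, mul_comm]
  have hhur : IsHurwitz (A - Q)ᵀ := by
    intro z hz
    rw [eigs_transpose, hQ] at hz
    nth_rw 1 [← hAX] at hz
    rw [← map_sub] at hz
    obtain ⟨μ, hμ, rfl⟩ := exists_eigenvalue_of_aeval _ _ hz
    rw [map_sub, aeval_X, Complex.sub_re]
    by_cases h0 : μ.re = 0
    · rw [hq1 μ hμ h0, h0]; norm_num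
    · rw [hq0 μ hμ h0, Complex.zero_re, sub_zero]
      exact lt_of_le_of_ne (not_lt.1 (hA μ hμ)) h0
  have him : ∀ z ∈ eigs (A * Q), z.re = 0 := by
    intro z hz
    rw [hQ] at hz
    nth_rw 1 [← hAX] at hz
    rw [← map_mul] at hz
    obtain ⟨μ, hμ, rfl⟩ := exists_eigenvalue_of_aeval _ _ hz
    rw [map_mul, aeval_X]
    by_cases h0 : μ.re = 0
    · rw [hq1 μ hμ h0, mul_one, h0]
    · rw [hq0 μ hμ h0, mul_zero, Complex.zero_re]
  obtain ⟨R, hR⟩ := hhur.exists_lyapunov 1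
  refine ⟨Q, R, hhur.lyapunov_posSemidef hR Matrix.PosSemidef.one,
    by rwa [Matrix.transpose_transpose] at hR, fun ε hε => ?_⟩
  obtain ⟨P, hP, hric, htr, hc⟩ := exists_parametric_riccati hqq hcomm him
    (fun μ v hv hQv hBv => by
      by_contra hv0
      have hμ : μ ∈ eigs (A * Q)ᵀ := by
        refine (mem_eigs_iff _ _).2 ⟨v, hv0, ?_⟩
        rw [hcomm, Matrix.transpose_mul, toC_mul, ← Matrix.mulVec_mulVec, hQv, hv]
      rw [eigs_transpose] at hμ
      exact hv0 (hctrl μ v (him μ hμ) hv hBv)) hε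
  exact ⟨P, ⟨hP, hε.le, hric, htr⟩, hc⟩

/-- Halanay's inequality for `x* P x + δ x* R x` gives an exponential bound, if the derivatives of
the two forms along the closed loop satisfy suitable delayed inequalities. -/
lemma asymptoticallyStabilizes_of_delayed_lyapunov {A Q P R : Matrix ι ι ℝ} {B : Matrix ι κ ℝ}
    {K : Matrix κ ι ℝ} {l : ℂ} {τ ε α C : ℝ} (hτ : 0 ≤ τ) (hP : P.PosSemidef)
    (hR : R.PosSemidef) (hAR : (A - Q)ᵀ * R + R * (A - Q) = -1) (hε : 0 < ε) (hεα : ε ≤ α)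
    (hC : 0 ≤ C)
    (hPder : ∀ x, IsClosedLoop A B l τ K x → ∀ t m, τ ≤ t →
      (∀ s ∈ Icc (t - 2 * τ) t, qform P (x s) ≤ m) →
      2 * (hform P (x t) (toC A *ᵥ x t + l • toC B *ᵥ (toC K *ᵥ x (t - τ)))).re ≤
        -ε * qform P (x t) + ε / 8 * m)
    (hRder : ∀ x, IsClosedLoop A B l τ K x → ∀ t m, τ ≤ t →
      (∀ s ∈ Icc (t - 2 * τ) t, qform P (x s) ≤ m) →
      2 * (hform R (x t) (toC A *ᵥ x t + l • toC B *ᵥ (toC K *ᵥ x (t - τ)))).re ≤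
        -α * qform R (x t) + C * m) :
    AsymptoticallyStabilizes A B l τ K := by
  set δ : ℝ := ε / (8 * (C + 1)) with hδ
  have hδ0 : 0 < δ := by positivity
  have hδC : δ * C ≤ ε / 8 := by
    rw [hδ, div_mul_eq_mul_div, div_le_div_iff₀ (by positivity) (by norm_num)]
    nlinarith
  obtain ⟨k, hk, hkR⟩ := exists_qform_one_le hR hAR
  obtain ⟨G, hG, hGx⟩ := exists_history_bound A B l hτ K
  obtain ⟨γ, hγ, hhal⟩ := exists_halanay_rate (a := ε) (b := ε / 4) (r := 2 * τ)
    (by linarith) (by linarith)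
  set Y : (ι → ℂ) → ℝ := fun x => qform P x + δ * qform R x with hY
  set b : ℝ := (P.trace + δ * R.trace) * Fintype.card ι with hb
  have hb0 : 0 ≤ b := by
    have h1 := hP.trace_nonneg
    have h2 := hR.trace_nonneg
    positivity
  have hYle : ∀ x, Y x ≤ b * ‖x‖ ^ 2 := by
    intro x
    have h1 := qform_le_trace_mul hP x
    have h2 := mul_le_mul_of_nonneg_left (qform_le_trace_mul hR x) hδ0.le
    have h3 : 0 ≤ P.trace + δ * R.trace := by
      have h1 := hP.trace_nonneg
      have h2 := hR.trace_nonneg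
      positivity
    have h4 := mul_le_mul_of_nonneg_left (qform_one_le_norm_sq x) h3
    simp only [hY, hb]
    linarith
  have hleY : ∀ x, ‖x‖ ^ 2 ≤ k / δ * Y x := by
    intro x
    calc ‖x‖ ^ 2 ≤ k * qform R x := (norm_sq_le_qform_one x).trans (hkR x)
      _ = k / δ * (δ * qform R x) := by field_simp
      _ ≤ _ := by
        gcongr
        simp only [hY]
        linarith [qform_nonneg hP x]
  refine asymptoticallyStabilizes_of_exponential_bound (G := G) (H := k / δ * (b * G ^ 2 + 1))
    (γ := γ) hG (by positivity) hγ fun x hx h hh hhist => ⟨hGx x hx h hhist, fun t ht => ?_⟩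
  have hbd := hhal τ (fun t => Y (x t))
    (fun t => 2 * (hform P (x t) (toC A *ᵥ x t + l • toC B *ᵥ (toC K *ᵥ x (t - τ)))).re +
      δ * (2 * (hform R (x t) (toC A *ᵥ x t + l • toC B *ᵥ (toC K *ᵥ x (t - τ)))).re))
    ((b * G ^ 2 + 1) * h ^ 2) (by positivity) ?_ ?_ ?_ ?_ t ht
  · calc ‖x t‖ ^ 2 ≤ k / δ * Y (x t) := hleY _
      _ ≤ k / δ * ((b * G ^ 2 + 1) * h ^ 2 * Real.exp (-γ * (t - τ))) := by gcongr
      _ = _ := by ring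
  · have hx1 : ContinuousOn x (Ici (τ - 2 * τ)) := by
      have : τ - 2 * τ = -τ := by ring
      rw [this]; exact hx.1
    have hform_cont : ∀ M : Matrix ι ι ℝ, Continuous fun v : ι → ℂ => qform M v := by
      intro M
      unfold qform hform dotProduct Matrix.mulVec dotProduct
      simp only [Pi.star_apply]
      fun_prop
    exact ((hform_cont P).comp_continuousOn hx1).add
      (((hform_cont R).comp_continuousOn hx1).const_mul δ)
  · intro t ht
    have ht0 : 0 < t := by linarith
    have h1 := hx.2 t ht0.le
    have h2 := (hasDerivWithinAt_qform (transpose_eq_of_posSemidef hP) h1).add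
      ((hasDerivWithinAt_qform (transpose_eq_of_posSemidef hR) h1).const_mul δ)
    exact h2.hasDerivAt (Ici_mem_nhds ht0)
  · intro t ht m hm
    have hPY : ∀ s ∈ Icc (t - 2 * τ) t, qform P (x s) ≤ m := fun s hs => by
      have h1 := hm s hs
      have h2 := mul_nonneg hδ0.le (qform_nonneg hR (x s))
      simp only [hY] at h1
      linarith
    have hm0 : 0 ≤ m := (qform_nonneg hP (x t)).trans (hPY t ⟨by linarith, le_rfl⟩)
    have h1 := hPder x hx t m ht.le hPY
    have h2 := mul_le_mul_of_nonneg_left (hRder x hx t m ht.le hPY) hδ0.le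
    have h3 := mul_le_mul_of_nonneg_right hδC hm0
    have h4 := mul_le_mul_of_nonneg_right hεα (mul_nonneg hδ0.le (qform_nonneg hR (x t)))
    simp only [hY]
    linarith
  · intro s hs
    have h1 := hGx x hx h hhist s ⟨by linarith [hs.1], hs.2⟩
    calc Y (x s) ≤ b * ‖x s‖ ^ 2 := hYle _
      _ ≤ b * (G * h) ^ 2 := by gcongr
      _ < _ := by nlinarith [pow_pos hh 2]

variable [DecidableEq κ]

/-- Low gain truncated predictor feedback. If no eigenvalue of `A` has positive real part and the
modes on the imaginary axis are controllable, then one real feedback stabilizes all the systems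
`x' = A x + l i B u(t - τ)` with `0 < Re (l i)`. -/
theorem exists_simultaneously_stabilizing_feedback {N : ℕ} {A : Matrix ι ι ℝ} {B : Matrix ι κ ℝ}
    (hA : ∀ μ ∈ eigs A, ¬ 0 < μ.re)
    (hctrl : ∀ (μ : ℂ) (v : ι → ℂ), μ.re = 0 → toC Aᵀ *ᵥ v = μ • v → toC Bᵀ *ᵥ v = 0 → v = 0)
    {τ : ℝ} (hτ : 0 ≤ τ) (l : Fin N → ℂ) (hl : ∀ i, 0 < (l i).re) :
    ∃ K : Matrix κ ι ℝ, ∀ i, AsymptoticallyStabilizes A B (l i) τ K := by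
  obtain ⟨Q, R, hR, hAR, hP⟩ := exists_lowGain_data hA hctrl
  set c : ℝ := ∑ i, ((l i).re)⁻¹ with hc
  set Λ : ℝ := ∑ i, ‖l i‖ with hΛ
  have hc0 : 0 ≤ c := Finset.sum_nonneg fun i _ => (inv_pos.2 (hl i)).le
  have hΛ0 : 0 ≤ Λ := Finset.sum_nonneg fun i _ => norm_nonneg _
  have hcl : ∀ i, 1 ≤ c * (l i).re := fun i => by
    rw [← inv_mul_cancel₀ (hl i).ne']
    exact mul_le_mul_of_nonneg_right (Finset.single_le_sum (f := fun i => ((l i).re)⁻¹)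
      (fun j _ => (inv_pos.2 (hl j)).le) (Finset.mem_univ i)) (hl i).le
  have hlΛ : ∀ i, ‖l i‖ ≤ Λ := fun i => Finset.single_le_sum (f := fun i => ‖l i‖)
    (fun j _ => norm_nonneg _) (Finset.mem_univ i)
  set d : ℝ := (Fintype.card ι : ℝ) with hd
  have hd0 : 0 ≤ d := Nat.cast_nonneg _
  have hRtr := hR.trace_nonneg
  set α : ℝ := 1 / (2 * (R.trace + 1)) with hα
  have hα0 : 0 < α := by positivity
  have hαR : ∀ x : ι → ℂ, α * qform R x ≤ 1 / 2 * qform 1 x := fun x => by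
    have h1 := qform_le_trace_mul hR x
    have h2 := qform_one_nonneg x
    rw [hα, div_mul_eq_mul_div, one_mul, div_le_iff₀ (by positivity)]
    linarith
  -- `ε` is so small that the error term of order `ε ^ 3` is dominated by `ε / 8`
  set E : ℝ := (c * Λ) ^ 4 * τ ^ 2 * Real.exp (2 * d * τ) * d ^ 3 with hE
  have hE0 : 0 ≤ E := by positivity
  obtain ⟨ε, hε, hε1, hεα, hεE⟩ : ∃ ε : ℝ, 0 < ε ∧ ε ≤ 1 ∧ ε ≤ α ∧ E * ε ≤ 1 / 8 := by
    refine ⟨min 1 (min α (1 / (8 * (E + 1)))), by positivity, min_le_left _ _,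
      (min_le_right _ _).trans (min_le_left _ _), ?_⟩
    have h1 : min 1 (min α (1 / (8 * (E + 1)))) ≤ 1 / (8 * (E + 1)) :=
      (min_le_right _ _).trans (min_le_right _ _)
    refine (mul_le_mul_of_nonneg_left h1 hE0).trans ?_
    rw [mul_one_div, div_le_div_iff₀ (by positivity) (by norm_num)]
    linarith
  obtain ⟨P, hPric, c₁, hc₁, hPQ⟩ := hP ε hε
  have hη := hPric.eta_nonneg
  set k : ℝ := 4 * (Rᵀ * R).trace with hk
  have hk0 : 0 ≤ k := by
    have := (posSemidef_transpose_mul R).trace_nonneg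
    positivity
  have hBtr := (posSemidef_transpose_mul B).trace_nonneg
  refine ⟨predictorGain A B P c τ, fun i => ?_⟩
  refine asymptoticallyStabilizes_of_delayed_lyapunov (ε := ε) (α := α)
    (C := k * (c₁ + Λ ^ 2 * ((Bᵀ * B).trace * (c ^ 2 * (d * ε * Real.exp (d * ε * τ)))))) hτ
    hPric.posSemidef hR hAR hε hεα (by positivity) (fun x hx t m ht hm => ?_)
    (fun x hx t m ht hm => ?_)
  · have hm0 : 0 ≤ m :=
      (qform_nonneg hPric.posSemidef (x t)).trans (hm t ⟨by linarith, le_rfl⟩)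
    refine (hPric.two_mul_re_hform_closedLoop_le hτ hx hc0 (hcl i) ht hm).trans ?_
    gcongr
    calc (c * ‖l i‖) ^ 4 * τ ^ 2 * Real.exp (2 * (d * ε) * τ) * (d * ε) ^ 3
        ≤ (c * Λ) ^ 4 * τ ^ 2 * Real.exp (2 * d * τ) * (d * ε) ^ 3 := by
          gcongr
          · exact hlΛ i
          · exact mul_le_of_le_one_right hd0 hε1
      _ = E * ε * ε * ε := by rw [hE]; ring
      _ ≤ 1 / 8 * 1 * ε := by gcongr
      _ = ε / 8 := by ring
  · have hxt := hm t ⟨by linarith, le_rfl⟩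
    have hxτ := hm (t - τ) ⟨by linarith, by linarith⟩
    have hm0 : 0 ≤ m := (qform_nonneg hPric.posSemidef (x t)).trans hxt
    refine (two_mul_re_hform_lyapunov_le hR hAR _ _).trans ?_
    have h1 : qform 1 (toC Q *ᵥ x t) ≤ c₁ * m := (hPQ _).trans (by gcongr)
    have h2 : qform 1 (l i • toC B *ᵥ (toC (predictorGain A B P c τ) *ᵥ x (t - τ))) ≤
        Λ ^ 2 * ((Bᵀ * B).trace * (c ^ 2 * (d * ε * (Real.exp (d * ε * τ) * m)))) := by
      rw [qform_smul]
      have h3 := hPric.qform_predictorGain_le hτ c (x (t - τ))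
      have h4 := qform_one_nonneg
        (toC B *ᵥ (toC (predictorGain A B P c τ) *ᵥ x (t - τ)))
      have h5 := qform_one_mulVec_le B (toC (predictorGain A B P c τ) *ᵥ x (t - τ))
      gcongr
      · exact hlΛ i
      · refine h5.trans ?_
        gcongr
        exact h3.trans (by gcongr)
    have h3 := hαR (x t)
    have h4 := mul_le_mul_of_nonneg_left (add_le_add h1 h2) hk0
    linarith

end Stabilization

/-! ### The augmented system -/

section InternalModel

/-- A matrix of full row rank has trivial left kernel. -/
lemma eq_zero_of_vecMul_eq_zero {F : Type*} [Field F] [Fintype ι] [Fintype κ] {M : Matrix ι κ F}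
    (hM : M.rank = Fintype.card ι) {v : ι → F} (hv : v ᵥ* M = 0) : v = 0 := by
  have h1 : LinearIndependent F M.row := by
    rw [linearIndependent_iff_card_eq_finrank_span, ← hM, Matrix.rank_eq_finrank_span_row]
    rfl
  exact Matrix.vecMul_injective_iff.2 h1 (by simp [hv])

lemma eq_zero_of_toC_transpose_mulVec_eq_zero [Fintype ι] [Fintype κ] {M : Matrix ι κ ℝ}
    (hM : M.rank = Fintype.card ι) {v : ι → ℂ} (hv : toC Mᵀ *ᵥ v = 0) : v = 0 := by
  have hv' : ∀ j, ∑ i, (M i j : ℂ) * v i = 0 := fun j => congrFun hv j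
  have hre : (fun i => (v i).re) = 0 := eq_zero_of_vecMul_eq_zero hM <| by
    ext j
    simpa [Matrix.vecMul, dotProduct, mul_comm] using congrArg Complex.re (hv' j)
  have him : (fun i => (v i).im) = 0 := eq_zero_of_vecMul_eq_zero hM <| by
    ext j
    simpa [Matrix.vecMul, dotProduct, mul_comm] using congrArg Complex.im (hv' j)
  ext i
  exact Complex.ext (congrFun hre i) (congrFun him i)

/-- The easy half of the Hautus test: a left eigenvector annihilated by the input matrix is
annihilated by the whole controllability matrix. -/
lemma Controllable.eq_zero_of_eigenvector {n m : ℕ} {A : Matrix (Fin n) (Fin n) ℝ}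
    {B : Matrix (Fin n) (Fin m) ℝ} (h : Controllable A B) {μ : ℂ} {v : Fin n → ℂ}
    (hv : toC Aᵀ *ᵥ v = μ • v) (hB : toC Bᵀ *ᵥ v = 0) : v = 0 := by
  refine eq_zero_of_toC_transpose_mulVec_eq_zero (M := ctrbMatrix A B)
    (by rw [Fintype.card_fin]; exact h) ?_
  have hpow : ∀ k : ℕ, toC (A ^ k * B)ᵀ *ᵥ v = 0 := by
    intro k
    have h1 : toC (A ^ k)ᵀ *ᵥ v = μ ^ k • v := by
      have := aeval_mulVec_real_eigenvector Aᵀ hv (Polynomial.X ^ k)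
      simpa [Matrix.transpose_pow] using this
    rw [Matrix.transpose_mul, toC_mul, ← Matrix.mulVec_mulVec, h1, Matrix.mulVec_smul, hB,
      smul_zero]
  ext kj
  exact congrFun (hpow kj.1) kj.2

lemma Stabilizable.eq_zero_of_eigenvector {n m : ℕ} {A : Matrix (Fin n) (Fin n) ℝ}
    {B : Matrix (Fin n) (Fin m) ℝ} (h : Stabilizable A B) {μ : ℂ} (hμ : μ.re = 0)
    {v : Fin n → ℂ} (hv : toC Aᵀ *ᵥ v = μ • v) (hB : toC Bᵀ *ᵥ v = 0) : v = 0 := by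
  obtain ⟨F, hF⟩ := h
  by_contra hv0
  have h1 : μ ∈ eigs (A + B * F)ᵀ := by
    refine (mem_eigs_iff _ _).2 ⟨v, hv0, ?_⟩
    rw [Matrix.transpose_add, Matrix.transpose_mul, toC_add, toC_mul, Matrix.add_mulVec,
      ← Matrix.mulVec_mulVec, hB, Matrix.mulVec_zero, add_zero, hv]
  rw [eigs_transpose] at h1
  exact (hF μ h1).ne hμ

lemma eigs_subset_of_charpoly_eq_minpoly {q s : ℕ} {S : Matrix (Fin q) (Fin q) ℝ}
    {β : Matrix (Fin s) (Fin s) ℝ} (h : β.charpoly = minpoly ℝ S) : eigs β ⊆ eigs S := by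
  intro μ hμ
  rw [mem_eigs_iff_aeval_charpoly] at hμ ⊢
  obtain ⟨g, hg⟩ := Matrix.minpoly_dvd_charpoly S
  rw [hg, map_mul, ← h, hμ, zero_mul]

variable {p s : ℕ}

lemma toC_one_kronecker_mulVec (β : Matrix (Fin s) (Fin s) ℝ) (z : Fin p × Fin s → ℂ) (j : Fin p)
    (k : Fin s) :
    (toC ((1 : Matrix (Fin p) (Fin p) ℝ) ⊗ₖ β) *ᵥ z) (j, k) =
      (toC β *ᵥ fun k' => z (j, k')) k := by
  simp only [Matrix.mulVec, dotProduct, toC_apply, Matrix.kroneckerMap_apply, Fintype.sum_prod_type]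
  rw [Finset.sum_eq_single j]
  · simp
  · intro b _ hb
    simp [Matrix.one_apply_ne hb.symm]
  · simp

lemma toC_fromBlocks {a b c d : Type*} (A : Matrix a c ℝ) (B : Matrix a d ℝ) (C : Matrix b c ℝ)
    (D : Matrix b d ℝ) :
    toC (Matrix.fromBlocks A B C D) = Matrix.fromBlocks (toC A) (toC B) (toC C) (toC D) :=
  Matrix.fromBlocks_map _ _ _ _ _

/-- The eigenvalues of the augmented system are among those of `A` and those of `S`. -/
lemma not_re_pos_of_mem_eigs_augA {n q : ℕ} {A : Matrix (Fin n) (Fin n) ℝ}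
    {C : Matrix (Fin p) (Fin n) ℝ} {S : Matrix (Fin q) (Fin q) ℝ}
    {G₁ : Matrix (Fin p × Fin s) (Fin p × Fin s) ℝ} {G₂ : Matrix (Fin p × Fin s) (Fin p) ℝ}
    (hG : IsMinimalInternalModel S G₁ G₂) (hS : ∀ μ ∈ eigs S, μ.re = 0)
    (hA : ∀ μ ∈ eigs A, ¬ 0 < μ.re) : ∀ μ ∈ eigs (augA A C G₁ G₂), ¬ 0 < μ.re := by
  obtain ⟨β, σ, hβ, -, rfl, -⟩ := hG
  intro μ hμ
  obtain ⟨v, hv0, hv⟩ := (mem_eigs_iff _ _).1 hμ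
  rw [augA, toC_fromBlocks, toC_zero, Matrix.fromBlocks_mulVec, Matrix.zero_mulVec, add_zero] at hv
  have h1 : toC A *ᵥ (v ∘ Sum.inl) = μ • (v ∘ Sum.inl) := by
    ext i; simpa using congrFun hv (Sum.inl i)
  by_cases ha : v ∘ Sum.inl = 0
  · have h2 : toC ((1 : Matrix (Fin p) (Fin p) ℝ) ⊗ₖ β) *ᵥ (v ∘ Sum.inr) =
        μ • (v ∘ Sum.inr) := by
      ext i
      have := congrFun hv (Sum.inr i)
      simpa [ha] using this
    have hz : v ∘ Sum.inr ≠ 0 := fun hz => hv0 <| by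
      ext (i | i)
      · exact congrFun ha i
      · exact congrFun hz i
    obtain ⟨⟨j, k⟩, hjk⟩ := Function.ne_iff.1 hz
    have h3 : μ ∈ eigs β := by
      refine (mem_eigs_iff _ _).2 ⟨fun k' => v (Sum.inr (j, k')),
        Function.ne_iff.2 ⟨k, hjk⟩, ?_⟩
      ext k'
      have := congrFun h2 (j, k')
      rwa [toC_one_kronecker_mulVec] at this
    rw [hS μ (eigs_subset_of_charpoly_eq_minpoly hβ h3)]
    exact lt_irrefl 0
  · exact hA μ ((mem_eigs_iff _ _).2 ⟨_, ha, h1⟩)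

/-- The Hautus test for the augmented system on the imaginary axis. If the internal model component
`z` of a left eigenvector does not vanish, then the eigenvalue belongs to `S`, and the rank
condition applies to the left kernel vector `(v, G₂ᵀ z)`. -/
lemma eq_zero_of_augA_eigenvector {n m q : ℕ} {A : Matrix (Fin n) (Fin n) ℝ}
    {B : Matrix (Fin n) (Fin m) ℝ} {C : Matrix (Fin p) (Fin n) ℝ} {S : Matrix (Fin q) (Fin q) ℝ}
    {G₁ : Matrix (Fin p × Fin s) (Fin p × Fin s) ℝ} {G₂ : Matrix (Fin p × Fin s) (Fin p) ℝ}
    (hG : IsMinimalInternalModel S G₁ G₂) (hAB : Stabilizable A B)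
    (hrank : RankCondition A B C S) (μ : ℂ) (v : Fin n ⊕ Fin p × Fin s → ℂ) (hμ : μ.re = 0)
    (hv : toC (augA A C G₁ G₂)ᵀ *ᵥ v = μ • v) (hB : toC (augB p s B)ᵀ *ᵥ v = 0) : v = 0 := by
  obtain ⟨β, σ, hβ, hβσ, hG₁, hG₂⟩ := hG
  set a := v ∘ Sum.inl with ha
  set z := v ∘ Sum.inr with hz
  rw [augA, Matrix.fromBlocks_transpose, toC_fromBlocks, Matrix.transpose_zero, toC_zero,
    Matrix.fromBlocks_mulVec, Matrix.zero_mulVec, zero_add, Matrix.transpose_mul, toC_mul,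
    ← Matrix.mulVec_mulVec] at hv
  have h1 : toC Aᵀ *ᵥ a + toC Cᵀ *ᵥ (toC G₂ᵀ *ᵥ z) = μ • a := by
    ext i; simpa [ha, hz] using congrFun hv (Sum.inl i)
  have h2 : toC G₁ᵀ *ᵥ z = μ • z := by
    ext i; simpa [hz] using congrFun hv (Sum.inr i)
  have h3 : toC Bᵀ *ᵥ a = 0 := by
    ext j
    have := congrFun hB j
    simpa [ha, Matrix.mulVec, dotProduct, augB, Fintype.sum_sum_type] using this
  have h4 : ∀ j, toC βᵀ *ᵥ (fun k => z (j, k)) = μ • fun k => z (j, k) := by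
    intro j
    ext k
    have := congrFun h2 (j, k)
    rwa [hG₁, ← Matrix.kroneckerMap_transpose, Matrix.transpose_one,
      toC_one_kronecker_mulVec] at this
  have hz0 : z = 0 := by
    by_contra hz0
    obtain ⟨⟨j, k⟩, hjk⟩ := Function.ne_iff.1 hz0
    have hμS : μ ∈ eigs S := by
      refine eigs_subset_of_charpoly_eq_minpoly hβ ?_
      rw [← eigs_transpose]
      exact (mem_eigs_iff _ _).2 ⟨_, Function.ne_iff.2 ⟨k, hjk⟩, h4 j⟩
    have hker : Sum.elim a (toC G₂ᵀ *ᵥ z) = 0 := by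
      refine eq_zero_of_vecMul_eq_zero (M := Matrix.fromBlocks
        (toC A - μ • (1 : Matrix (Fin n) (Fin n) ℂ)) (toC B) (toC C) 0) ?_ ?_
      · rw [hrank μ hμS, Fintype.card_sum, Fintype.card_fin, Fintype.card_fin]
      · rw [Matrix.vecMul_fromBlocks, Sum.elim_comp_inl, Sum.elim_comp_inr, Matrix.vecMul_sub,
          Matrix.vecMul_smul, Matrix.vecMul_one, Matrix.vecMul_zero, add_zero,
          ← Matrix.mulVec_transpose, ← Matrix.mulVec_transpose, ← Matrix.mulVec_transpose,
          ← toC_transpose, ← toC_transpose, ← toC_transpose, h3, sub_add_eq_add_sub, h1, sub_self]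
        exact Sum.elim_zero_zero
    have hzj : (fun k => z (j, k)) = 0 := by
      refine hβσ.eq_zero_of_eigenvector (h4 j) ?_
      ext i
      have := congrFun hker (Sum.inr j)
      simp only [Sum.elim_inr, Pi.zero_apply, hG₂, Matrix.mulVec, dotProduct, toC_apply,
        Matrix.transpose_apply, Matrix.of_apply, Fintype.sum_prod_type] at this
      rw [Finset.sum_eq_single j (fun b _ hb => by simp [hb]) (by simp)] at this
      simpa [Matrix.mulVec, dotProduct] using this
    exact hjk (congrFun hzj k)
  have ha0 : a = 0 := by
    rw [hz0, Matrix.mulVec_zero, Matrix.mulVec_zero, add_zero] at h1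
    exact hAB.eq_zero_of_eigenvector hμ h1 h3
  ext (i | i)
  · exact congrFun ha0 i
  · exact congrFun hz0 i

end InternalModel

end DelayReg

theorem mainTheorem4 {n m p q s N : ℕ}
    (A : Matrix (Fin n) (Fin n) ℝ) (B : Matrix (Fin n) (Fin m) ℝ)
    (C : Matrix (Fin p) (Fin n) ℝ) (S : Matrix (Fin q) (Fin q) ℝ)
    (G₁ : Matrix (Fin p × Fin s) (Fin p × Fin s) ℝ) (G₂ : Matrix (Fin p × Fin s) (Fin p) ℝ)
    (hG : DelayReg.IsMinimalInternalModel S G₁ G₂)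
    (hS : ∀ μ ∈ DelayReg.eigs S, μ.re = 0)
    (hAB : DelayReg.Stabilizable A B)
    (hrank : DelayReg.RankCondition A B C S)
    (hA : ∀ μ ∈ DelayReg.eigs A, ¬ 0 < μ.re)
    (τ : ℝ) (hτ : 0 ≤ τ)
    (l : Fin N → ℂ) (hl : ∀ i, 0 < (l i).re) :
    ∃ K : Matrix (Fin m) (Fin n ⊕ Fin p × Fin s) ℝ, ∀ i : Fin N,
      DelayReg.AsymptoticallyStabilizes (DelayReg.augA A C G₁ G₂) (DelayReg.augB p s B)
        (l i) τ K := by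
  exact DelayReg.exists_simultaneously_stabilizing_feedback
    (DelayReg.not_re_pos_of_mem_eigs_augA hG hS hA)
    (DelayReg.eq_zero_of_augA_eigenvector hG hAB hrank) hτ l hl
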